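/- **Setting.** Let $T$ be a compact metric space and let $\mathbb C_0$ be the set of continuous functions $f:T\to[0,\infty)$ that are not identically zero, with the sup norm $\|\cdot\|$ and its Borel $\sigma$-algebra. Let $M_p(\mathbb C_0)$ be the space of point measures $M=\sum_{i\in I}\delta_{f_i}$ on $\mathbb C_0$ ($I$ countable) such that $\{i\in I:\|f_i\|>\varepsilon\}$ is finite for every $\varepsilon>0$, with the $\sigma$-algebra generated by the maps $M\mapsto M(A)$, $A\subset\mathbb C_0$ Borel. Write $[M]$ for the set of atoms of $M$ and $\max(M)(t)=\max\{f(t):f\in[M]\}$ ($\max(M)\equiv0$ if $M=0$). For $S\subset T$, write $f<_S g$ (equivalently $g>_S f$) if $f(t)<g(t)$ for all $t\in S$, and $f\not<_S g$ otherwise. Put $$C_S^-(g)=\{M\in M_p(\mathbb C_0):\ \forall f\in[M],\ f<_S g\}.$$ Let $\mu$ be a Borel measure on $\mathbb C_0$ and let $\Phi=\sum_{i=1}^N\delta_{\phi_i}$ be an $M_p(\mathbb C_0)$-valued Poisson random measure with intensity $\mu$, defined on a probability space $(\Omega,\mathcal F,\mathbb P)$ (so necessarily $\mu(\{\|f\|>\varepsilon\})<\infty$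 for all $\varepsilon>0$). Let $\eta=\max(\Phi)$ and, for $S\subset T$, $$\Phi_S^+=\sum_{i=1}^N 1_{\{\phi_i\not<_S\eta\}}\delta_{\phi_i},\qquad \Phi_S^-=\sum_{i=1}^N 1_{\{\phi_i<_S\eta\}}\delta_{\phi_i}.$$ **Assumption (A).** $K=\{t_1,\dots,t_k\}\subset T$ is finite (with distinct $t_i$) and, for every $t\in K$, the function $\bar\mu_t(x)=\mu(\{f\in\mathbb C_0: f(t)\ge x\})$ is continuous on $(0,\infty)$ with $\bar\mu_t(0^+)=+\infty$. Under (A), almost surely, for every $t\in K$ there is a unique function $\phi_t^+$ with $\Phi_{\{t\}}^+=\delta_{\phi_t^+}$. Order $K$ by $t_1<\dots<t_k$ and write every partition of $K$ as $\tau=(\tau_1,\dots,\tau_\ell)$ with $\min\tau_1<\dots<\min\tau_\ell$. The *hitting scenario* $\Theta=(\theta_1,\dots,\theta_{\ell(\Theta)})$ is the random partition of $K$ into the classes of the equivalence relation $t\sim t'\iff\phi_t^+=\phi_{t'}^+$, and $\varphi_j^+$ denotes the common value of $\phi_t^+$ for $t\in\theta_j$. **Proposition 2.3.** Suppose that (A)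 holds. Then for every partition $\tau=(\tau_1,\dots,\tau_\ell)$ of $K$ and all measurable sets $A\subset\mathbb C_0^\ell$ and $B\subset M_p(\mathbb C_0)$, $$\mathbb P\big[\Theta=\tau,\ (\varphi_1^+,\dots,\varphi_\ell^+)\in A,\ \Phi_K^-\in B\big] =\int_A 1_{\{\forall j\in\{1,\dots,\ell\},\ f_j>_{\tau_j}\bigvee_{j'\ne j}f_{j'}\}}\;\mathbb P\Big[\Phi\in B\cap C_K^-\Big(\bigvee_{j=1}^\ell f_j\Big)\Big]\,\mu^{\otimes\ell}(df_1,\dots,df_\ell),$$ where $\bigvee$ is the pointwise supremum and an empty supremum is $0$. -/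

import Mathlib

open MeasureTheory ProbabilityTheory Filter Topology Set
open scoped ENNReal NNReal

noncomputable section

namespace MaxID

/-- The space `ℂ₀` of continuous functions `T → ℝ` that are non-negative and not identically
zero, with the metric of the sup norm (for compact `T`). -/
abbrev C0 (T : Type*) [TopologicalSpace T] : Type _ :=
  {f : C(T, ℝ) // (∀ t, 0 ≤ f t) ∧ f ≠ 0}

section Functions

variable {T : Type*}

/-- `f <_S g`, that is, `f t < g t` for every `t ∈ S`. -/
def LtOn (S : Set T) (f g : T → ℝ) : Prop :=
  ∀ t ∈ S, f t < g t

end Functions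

variable {T : Type*} [MetricSpace T] [CompactSpace T]

/-- `ℂ₀` carries its Borel σ-algebra. -/
instance instMeasurableSpaceC0 : MeasurableSpace (C0 T) := borel (C0 T)

instance instBorelSpaceC0 : BorelSpace (C0 T) := ⟨rfl⟩

/-- The constant function `1`; it shows that `ℂ₀` is non-empty as soon as `T` has a point. -/
theorem nonempty_C0 {T : Type*} [TopologicalSpace T] (t : T) : Nonempty (C0 T) :=
  ⟨⟨1, fun _ => zero_le_one, fun h => one_ne_zero (DFunLike.congr_fun h t)⟩⟩

/-- `M` is a point measure `∑ i ∈ I, δ_{f i}` with `I` countable and, for every `ε > 0`, only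
finitely many indices `i` (so atoms are counted with multiplicity) such that `‖f i‖ > ε`. -/
def IsPointMeasure (M : Measure (C0 T)) : Prop :=
  ∃ (I : Type) (_ : Countable I) (f : I → C0 T),
    M = Measure.sum (fun i => Measure.dirac (f i)) ∧
      ∀ ε : ℝ, 0 < ε → {i | ε < ‖(f i).1‖}.Finite

variable (T) in
/-- The space `M_p(ℂ₀)` of point measures. Its σ-algebra, inherited from the one of `Measure`,
is generated by the maps `M ↦ M A` for `A ⊆ ℂ₀` Borel. -/
abbrev PointMeasure : Type _ :=
  {M : Measure (C0 T) // IsPointMeasure M}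

theorem IsPointMeasure.restrict {M : Measure (C0 T)} (hM : IsPointMeasure M) (s : Set (C0 T)) :
    IsPointMeasure (M.restrict s) := by
  classical
  obtain ⟨I, hI, f, rfl, hf⟩ := hM
  refine ⟨{i : I // f i ∈ s}, inferInstance, fun i => f i.1, ?_, fun ε hε => ?_⟩
  · rw [Measure.restrict_sum_of_countable]
    ext A hA
    rw [Measure.sum_apply _ hA, Measure.sum_apply _ hA]
    simp only [MeasureTheory.restrict_dirac]
    rw [← tsum_subtype_eq_of_support_subset (s := {i | f i ∈ s})
      (f := fun i => (if f i ∈ s then Measure.dirac (f i) else 0 : Measure (C0 T)) A)]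
    · refine tsum_congr fun i => ?_
      have hi : f i.1 ∈ s := i.2
      rw [if_pos hi]
    · intro i hi
      by_contra h
      have h' : ¬ f i ∈ s := h
      simp [h'] at hi
  · have h : {i : {i : I // f i ∈ s} | ε < ‖(f i.1).1‖} = Subtype.val ⁻¹' {i | ε < ‖(f i).1‖} := rfl
    rw [h]
    exact (hf ε hε).preimage Subtype.val_injective.injOn

namespace PointMeasure

/-- The restriction of the point measure `∑ δ_{f i}` to those atoms `f i` lying in `s`. -/
def restrict (M : PointMeasure T) (s : Set (C0 T)) : PointMeasure T :=
  ⟨M.1.restrict s, M.2.restrict s⟩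

/-- The set `[M]` of atoms of `M`. -/
def atoms (M : PointMeasure T) : Set (C0 T) :=
  {f | M.1 {f} ≠ 0}

/-- The function `max(M) : t ↦ max {f t | f ∈ [M]}`, equal to `0` if `M = 0`. For a point measure
the set of values is bounded, so the supremum is a genuine one, unless `[M] = ∅`, when the
convention `sSup ∅ = 0` gives the value `0`. -/
def max (M : PointMeasure T) (t : T) : ℝ :=
  sSup ((fun f : C0 T => f.1 t) '' M.atoms)

/-- The `S`-extremal part `M_S^+` of `M`: the atoms `f` with `f ≮_S max(M)`. -/
def extremal (S : Set T) (M : PointMeasure T) : PointMeasure T :=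
  M.restrict {f | ¬ LtOn S f.1 M.max}

/-- The `S`-sub-extremal part `M_S^-` of `M`: the atoms `f` with `f <_S max(M)`. -/
def subExtremal (S : Set T) (M : PointMeasure T) : PointMeasure T :=
  M.restrict {f | LtOn S f.1 M.max}

/-- The set `C_S^-(g)` of the point measures all of whose atoms `f` satisfy `f <_S g`. -/
def CMinus (S : Set T) (g : T → ℝ) : Set (PointMeasure T) :=
  {M | ∀ f ∈ M.atoms, LtOn S f.1 g}

/-- The `t`-extremal function `φ_t^+` of `M`: the function such that `M_{t}^+ = δ_{φ_t^+}`
(an arbitrary element of `ℂ₀` if there is no such function). -/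
def extremalFun (M : PointMeasure T) (t : T) : C0 T :=
  @Classical.epsilon (C0 T) (nonempty_C0 t)
    (fun φ => (M.extremal {t}).1 = Measure.dirac φ)

end PointMeasure

section Partitions

variable {k : ℕ}

/-- The indices that are the least element of their component of the partition `τ`. -/
def minima (τ : Finpartition (Finset.univ : Finset (Fin k))) : Finset (Fin k) :=
  {i | ∀ i' ∈ τ.part i, i ≤ i'}

/-- The length `ℓ(τ)` of a partition: the number of its components. -/
def len (τ : Finpartition (Finset.univ : Finset (Fin k))) : ℕ :=
  τ.parts.card

theorem card_minima (τ : Finpartition (Finset.univ : Finset (Fin k))) :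
    (minima τ).card = len τ := by
  refine Finset.card_bij (fun i _ => τ.part i) ?_ ?_ ?_
  · intro i _
    exact τ.part_mem.2 (Finset.mem_univ i)
  · intro i hi j hj hij
    simp only [minima, Finset.mem_filter, Finset.mem_univ, true_and] at hi hj
    refine le_antisymm (hi j ?_) (hj i ?_)
    · have : τ.part i = τ.part j := hij
      rw [this]
      exact τ.mem_part (Finset.mem_univ j)
    · have : τ.part i = τ.part j := hij
      rw [← this]
      exact τ.mem_part (Finset.mem_univ i)
  · intro p hp
    have hne : p.Nonempty := τ.nonempty_of_mem_parts hp
    have hpart : τ.part (p.min' hne) = p :=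
      τ.part_eq_of_mem hp (p.min'_mem hne)
    refine ⟨p.min' hne, ?_, hpart⟩
    simp only [minima, Finset.mem_filter, Finset.mem_univ, true_and]
    intro i' hi'
    rw [hpart] at hi'
    exact p.min'_le i' hi'

/-- The number `min τ_j`, where `τ_1, …, τ_ℓ` are the components of `τ` in the standardized order
`min τ_1 < ⋯ < min τ_ℓ`. -/
def blockMin (τ : Finpartition (Finset.univ : Finset (Fin k))) (j : Fin (len τ)) : Fin k :=
  (minima τ).orderEmbOfFin (card_minima τ) j

/-- The component `τ_j` of `τ`, in the standardized order `min τ_1 < ⋯ < min τ_ℓ`. -/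
def block (τ : Finpartition (Finset.univ : Finset (Fin k))) (j : Fin (len τ)) : Finset (Fin k) :=
  τ.part (blockMin τ j)

end Partitions

namespace PointMeasure

variable {k : ℕ}

open Classical in
/-- The hitting scenario `Θ` of `M` at `K = {t_1, …, t_k}`: the partition of (the index set of) `K`
into the classes of the equivalence relation `φ_t^+ = φ_{t'}^+`. -/
def hittingScenario (t : Fin k → T) (M : PointMeasure T) :
    Finpartition (Finset.univ : Finset (Fin k)) :=
  Finpartition.ofSetoid (Setoid.ker fun i => M.extremalFun (t i))

/-- The extremal function `φ_j^+` of the component `θ_j` of the hitting scenario: the common value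
of `φ_t^+` over `t ∈ θ_j`, read off at the first point of `θ_j`. -/
def extremalFuns (t : Fin k → T) (M : PointMeasure T)
    (j : Fin (len (M.hittingScenario t))) : C0 T :=
  M.extremalFun (t (blockMin (M.hittingScenario t) j))

end PointMeasure

/-- `Φ` is an `M_p(ℂ₀)`-valued Poisson random measure with intensity measure `μ`: it is measurable,
`Φ(A)` is Poisson distributed with mean `μ(A)` for Borel `A` (almost surely infinite when
`μ(A) = ∞`), and `Φ(A_1), …, Φ(A_n)` are independent for pairwise disjoint Borel sets. -/
structure IsPoissonRandomMeasure {Ω : Type*} [MeasurableSpace Ω] (P : Measure Ω)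
    (μ : Measure (C0 T)) (Φ : Ω → PointMeasure T) : Prop where
  measurable : Measurable Φ
  law_of_finite : ∀ A : Set (C0 T), MeasurableSet A → μ A ≠ ∞ →
    P.map (fun ω => (Φ ω).1 A) =
      (poissonMeasure (μ A).toNNReal).map (fun n : ℕ => (n : ℝ≥0∞))
  ae_eq_top : ∀ A : Set (C0 T), MeasurableSet A → μ A = ∞ → ∀ᵐ ω ∂P, (Φ ω).1 A = ∞
  indep : ∀ (n : ℕ) (A : Fin n → Set (C0 T)), (∀ i, MeasurableSet (A i)) →
    Pairwise (fun i j => Disjoint (A i) (A j)) →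
    iIndepFun (fun i ω => (Φ ω).1 (A i)) P

/-- The tail function `x ↦ μ {f | f t ≥ x}` (`x > 0`) of the margin at `t` of `μ`. -/
def tail (μ : Measure (C0 T)) (t : T) (x : ℝ) : ℝ≥0∞ :=
  μ {f | x ≤ f.1 t}

/-- At every point `t i`, the tail function of `μ` is continuous on `(0, ∞)` and tends to `∞`
at `0+`. -/
def AssumptionA {k : ℕ} (μ : Measure (C0 T)) (t : Fin k → T) : Prop :=
  ∀ i, ContinuousOn (tail μ (t i)) (Ioi 0) ∧ Tendsto (tail μ (t i)) (𝓝[>] 0) (𝓝 ∞)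

end MaxID

end

noncomputable section

namespace MaxID

/-! The event is the mass of a set of tuples of points of `Φ`, and Mecke's formula computes the
expected mass.

Call `M` regular if at each `t i` its maximum is positive and attained by exactly one atom, counted
with multiplicity. For regular `M`, the only tuple that can hit the maximum exactly on the blocks of
`τ` is the tuple of extremal functions. Hence the product measure `M^⊗ℓ` gives `scenarioSet` mass
one if the event occurs and zero otherwise (`pi_scenarioSet`). Assumption (A) makes `Φ` almost
surely regular (`ae_isRegularAt`).

The multivariate Mecke formula (`mecke_pi`) turns the expected mass into an integral over `f` with
respect to `μ^⊗ℓ`, with `Φ` replaced by `Φ + ∑ δ_{f j}`. The ordinary product measure may stand for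
the sum over distinct points because tuples in `scenarioSet` are injective. A deterministic
computation (`addDiracs_mem_scenarioSet_iff`) then shows that `(M + ∑ δ_{f j}, f)` lies in
`scenarioSet` exactly when `f ∈ A`, each `f j` dominates on its block, and `M` lies in `B` and
strictly below the supremum of the `f j`. This is the integrand of the claim.

Mecke's formula itself is derived from the count distributions: the size-biasing identity of the
Poisson law, independence on disjoint sets, and uniqueness of measures on π-systems. As `μ` may be
infinite, sets are first confined to shells `level T n`, which have finite intensity. -/

theorem continuous_eval_C0 {T : Type*} [TopologicalSpace T] (t : T) :
    Continuous fun f : C0 T => f.1 t :=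
  (continuous_eval_const t).comp continuous_subtype_val

theorem measurable_eval_C0 {T : Type*} [MetricSpace T] (t : T) :
    Measurable fun f : C0 T => f.1 t :=
  (continuous_eval_C0 t).measurable

variable {T : Type*} [MetricSpace T] [CompactSpace T]

theorem measurable_norm_C0 : Measurable fun f : C0 T => ‖f.1‖ :=
  (continuous_norm.comp continuous_subtype_val).measurable

theorem C0.norm_pos (f : C0 T) : 0 < ‖f.1‖ :=
  norm_pos_iff.2 f.2.2

theorem C0.apply_le_norm (f : C0 T) (t : T) : f.1 t ≤ ‖f.1‖ :=
  (le_abs_self _).trans (f.1.norm_coe_le_norm t)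

/-! ### Shells of finite mass -/

variable (T) in
/-- The functions `f` with `1 / (n + 1) < ‖f‖ ≤ 1 / n`. -/
def level (n : ℕ) : Set (C0 T) :=
  {f | ⌊1 / ‖f.1‖⌋₊ = n}

theorem measurableSet_level (n : ℕ) : MeasurableSet (level T n) :=
  (Nat.measurable_floor.comp (measurable_norm_C0.const_div 1)) (measurableSet_singleton n)

theorem pairwise_disjoint_level : Pairwise (Function.onFun Disjoint (level T)) := by
  intro m n hmn
  refine Set.disjoint_left.2 fun f hf hf' => hmn ?_
  exact (show ⌊1 / ‖f.1‖⌋₊ = m from hf).symm.trans hf'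

theorem iUnion_level : ⋃ n, level T n = univ :=
  eq_univ_of_forall fun _ => mem_iUnion.2 ⟨_, rfl⟩

theorem level_subset (n : ℕ) : level T n ⊆ {f | 1 / ((n : ℝ) + 1) < ‖f.1‖} := by
  intro f hf
  have h : 1 / ‖f.1‖ < (n : ℝ) + 1 := by
    have := Nat.lt_floor_add_one (1 / ‖f.1‖)
    rwa [show ⌊1 / ‖f.1‖⌋₊ = n from hf] at this
  exact (one_div_lt (f.norm_pos) (by positivity)).1 h

theorem sum_dirac_apply_eq_zero_iff {ι X : Type*} [MeasurableSpace X] (f : ι → X) {s : Set X}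
    (hs : MeasurableSet s) :
    Measure.sum (fun i => Measure.dirac (f i)) s = 0 ↔ ∀ i, f i ∉ s := by
  rw [Measure.sum_apply _ hs, ENNReal.tsum_eq_zero]
  refine forall_congr' fun i => ?_
  rw [Measure.dirac_apply' _ hs]
  simp

theorem isPointMeasure_zero : IsPointMeasure (0 : Measure (C0 T)) :=
  ⟨Empty, inferInstance, Empty.elim, by ext s hs; simp, fun _ _ => Set.toFinite _⟩

theorem isPointMeasure_dirac (f : C0 T) : IsPointMeasure (Measure.dirac f) :=
  ⟨Unit, inferInstance, fun _ => f, by simp,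
    fun _ _ => Set.toFinite _⟩

theorem IsPointMeasure.add {M N : Measure (C0 T)} (hM : IsPointMeasure M)
    (hN : IsPointMeasure N) : IsPointMeasure (M + N) := by
  obtain ⟨I, hI, f, rfl, hf⟩ := hM
  obtain ⟨J, hJ, g, rfl, hg⟩ := hN
  refine ⟨I ⊕ J, inferInstance, Sum.elim f g, ?_, fun ε hε => ?_⟩
  · ext s hs
    rw [Measure.add_apply, Measure.sum_apply _ hs, Measure.sum_apply _ hs, Measure.sum_apply _ hs,
      ENNReal.summable.tsum_sum ENNReal.summable]
    rfl
  · refine (((hf ε hε).image Sum.inl).union ((hg ε hε).image Sum.inr)).subset ?_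
    rintro (i | j) h
    · exact Or.inl ⟨i, h, rfl⟩
    · exact Or.inr ⟨j, h, rfl⟩

theorem isPointMeasure_finsetSum_dirac {ι : Type*} (s : Finset ι) (f : ι → C0 T) :
    IsPointMeasure (∑ j ∈ s, Measure.dirac (f j)) := by
  classical
  induction s using Finset.induction_on with
  | empty => simpa using isPointMeasure_zero
  | insert a s ha ih =>
    rw [Finset.sum_insert ha]
    exact (isPointMeasure_dirac _).add ih

/-! ### Point measures: atoms, maximum, measurability -/

namespace PointMeasure

/-- The point measure `M + ∑ j, δ_{f j}`. -/
def addDiracs {ι : Type*} [Fintype ι] (M : PointMeasure T) (f : ι → C0 T) : PointMeasure T :=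
  ⟨M.1 + ∑ j, Measure.dirac (f j), M.2.add (isPointMeasure_finsetSum_dirac _ f)⟩

/-- The point measure `M + δ_f`. -/
def addDirac (M : PointMeasure T) (f : C0 T) : PointMeasure T :=
  ⟨M.1 + Measure.dirac f, M.2.add (isPointMeasure_dirac f)⟩

theorem addDiracs_zero (M : PointMeasure T) (f : Fin 0 → C0 T) : M.addDiracs f = M :=
  Subtype.ext (by simp [addDiracs])

theorem addDiracs_cons {n : ℕ} (M : PointMeasure T) (g : C0 T) (f : Fin n → C0 T) :
    M.addDiracs (Fin.cons g f : Fin (n + 1) → C0 T) = (M.addDiracs f).addDirac g :=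
  Subtype.ext (by simp [addDiracs, addDirac, Fin.sum_univ_succ, add_comm, add_left_comm])

theorem measurable_apply {s : Set (C0 T)} (hs : MeasurableSet s) :
    Measurable fun M : PointMeasure T => M.1 s :=
  (Measure.measurable_coe hs).comp measurable_subtype_coe

theorem measurable_of_apply {X : Type*} [MeasurableSpace X] {φ : X → PointMeasure T}
    (h : ∀ s, MeasurableSet s → Measurable fun x => (φ x).1 s) : Measurable φ :=
  (Measure.measurable_of_measurable_coe _ h).subtype_mk

theorem measurable_addDirac :
    Measurable fun p : PointMeasure T × C0 T => p.1.addDirac p.2 := by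
  refine measurable_of_apply fun s hs => ?_
  simp only [addDirac, Measure.add_apply]
  exact ((measurable_apply hs).comp measurable_fst).add
    (((Measure.measurable_coe hs).comp Measure.measurable_dirac).comp measurable_snd)

theorem measurable_addDiracs {n : ℕ} :
    Measurable fun p : PointMeasure T × (Fin n → C0 T) => p.1.addDiracs p.2 := by
  refine measurable_of_apply fun s hs => ?_
  simp only [addDiracs, Measure.add_apply, Measure.finsetSum_apply]
  exact ((measurable_apply hs).comp measurable_fst).add
    (Finset.measurable_sum _ fun j _ =>
      ((Measure.measurable_coe hs).comp Measure.measurable_dirac).comp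
        ((measurable_pi_apply j).comp measurable_snd))

theorem mem_atoms_iff {I : Type*} {f : I → C0 T} {M : PointMeasure T}
    (h : M.1 = Measure.sum fun i => Measure.dirac (f i)) {g : C0 T} :
    g ∈ M.atoms ↔ ∃ i, f i = g := by
  rw [atoms, mem_ofPred_eq, h, Ne, sum_dirac_apply_eq_zero_iff _ (measurableSet_singleton g)]
  simp

theorem apply_eq_zero_iff (M : PointMeasure T) {s : Set (C0 T)} (hs : MeasurableSet s) :
    M.1 s = 0 ↔ ∀ g ∈ M.atoms, g ∉ s := by
  obtain ⟨I, _, f, h, -⟩ := M.2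
  rw [h, sum_dirac_apply_eq_zero_iff _ hs]
  simp only [mem_atoms_iff h]
  exact ⟨fun H g ⟨i, hi⟩ => hi ▸ H i, fun H i => H _ ⟨i, rfl⟩⟩

theorem apply_lt_top (M : PointMeasure T) {ε : ℝ} (hε : 0 < ε) :
    M.1 {f | ε < ‖f.1‖} < ∞ := by
  obtain ⟨I, _, f, h, hf⟩ := M.2
  have hm : MeasurableSet {f : C0 T | ε < ‖f.1‖} :=
    measurableSet_lt measurable_const measurable_norm_C0
  rw [h, Measure.sum_apply _ hm, tsum_eq_sum (s := (hf ε hε).toFinset)]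
  · refine ENNReal.sum_lt_top.2 fun i _ => ?_
    exact measure_lt_top _ _
  · intro i hi
    rw [Measure.dirac_apply' _ hm, indicator_of_notMem]
    simpa using hi

theorem apply_level_lt_top (M : PointMeasure T) (n : ℕ) : M.1 (level T n) < ∞ :=
  (measure_mono (level_subset n)).trans_lt (M.apply_lt_top (by positivity))

instance (M : PointMeasure T) : SigmaFinite M.1 :=
  ⟨⟨{ set := level T
      set_mem := fun _ => trivial
      finite := M.apply_level_lt_top
      spanning := iUnion_level }⟩⟩

theorem finite_atoms (M : PointMeasure T) {ε : ℝ} (hε : 0 < ε) :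
    {g ∈ M.atoms | ε < ‖g.1‖}.Finite := by
  obtain ⟨I, _, f, h, hf⟩ := M.2
  refine ((hf ε hε).image f).subset ?_
  rintro g ⟨hg, hgε⟩
  obtain ⟨i, rfl⟩ := (mem_atoms_iff h).1 hg
  exact ⟨i, hgε, rfl⟩

/-- Mass counts indices, so two distinct indices in `s` would give mass at least two even if they
carry the same function. -/
theorem exists_restrict_eq_dirac (M : PointMeasure T) {s : Set (C0 T)} (hs : MeasurableSet s)
    (h1 : M.1 s = 1) : ∃ g ∈ s, M.1.restrict s = Measure.dirac g := by
  classical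
  obtain ⟨I, _, f, h, -⟩ := M.2
  obtain ⟨i, hi⟩ : ∃ i, f i ∈ s := by
    by_contra! H
    rw [h, (sum_dirac_apply_eq_zero_iff _ hs).2 H] at h1
    exact zero_ne_one h1
  have huniq : ∀ j, j ≠ i → f j ∉ s := by
    intro j hj hjs
    have h2 : ∑ a ∈ {i, j}, (Measure.dirac (f a) s : ℝ≥0∞) ≤ M.1 s := by
      rw [h, Measure.sum_apply _ hs]
      exact ENNReal.sum_le_tsum _
    rw [Finset.sum_pair hj.symm, Measure.dirac_apply_of_mem hi, Measure.dirac_apply_of_mem hjs,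
      h1] at h2
    norm_num at h2
  refine ⟨f i, hi, ?_⟩
  ext A hA
  rw [Measure.restrict_apply hA, h, Measure.sum_apply _ (hA.inter hs), tsum_eq_single i]
  · rw [Measure.dirac_apply' _ (hA.inter hs), Measure.dirac_apply' _ hA]
    simp [indicator, hi]
  · intro j hj
    rw [Measure.dirac_apply' _ (hA.inter hs), indicator_of_notMem]
    exact fun hj' => huniq j hj hj'.2

theorem bddAbove_atoms (M : PointMeasure T) (t : T) :
    BddAbove ((fun f : C0 T => f.1 t) '' M.atoms) := by
  obtain ⟨b, hb⟩ := ((M.finite_atoms one_pos).image fun f : C0 T => f.1 t).bddAbove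
  refine ⟨Max.max b 1, ?_⟩
  rintro _ ⟨g, hg, rfl⟩
  rcases lt_or_ge 1 ‖g.1‖ with h | h
  · exact (hb ⟨g, ⟨hg, h⟩, rfl⟩).trans (le_max_left _ _)
  · exact ((g.apply_le_norm t).trans h).trans (le_max_right _ _)

theorem apply_le_max {M : PointMeasure T} {g : C0 T} (hg : g ∈ M.atoms) (t : T) :
    g.1 t ≤ M.max t :=
  le_csSup (M.bddAbove_atoms t) ⟨g, hg, rfl⟩

theorem max_nonneg (M : PointMeasure T) (t : T) : 0 ≤ M.max t := by
  refine Real.sSup_nonneg ?_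
  rintro _ ⟨g, -, rfl⟩
  exact g.2.1 t

theorem max_le {M : PointMeasure T} {t : T} {x : ℝ} (hx : 0 ≤ x)
    (h : ∀ g ∈ M.atoms, g.1 t ≤ x) : M.max t ≤ x := by
  refine Real.sSup_le ?_ hx
  rintro _ ⟨g, hg, rfl⟩
  exact h g hg

theorem lt_max_iff {M : PointMeasure T} {t : T} {x : ℝ} (hx : 0 ≤ x) :
    x < M.max t ↔ ∃ g ∈ M.atoms, x < g.1 t := by
  refine ⟨fun h => ?_, fun ⟨g, hg, h⟩ => h.trans_le (apply_le_max hg t)⟩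
  by_contra! H
  exact absurd (max_le hx H) (not_le.2 h)

/-- Only finitely many atoms have norm above half the maximum, and the others cannot compete at `t`.
-/
theorem exists_apply_eq_max {M : PointMeasure T} {t : T} (h : 0 < M.max t) :
    ∃ g ∈ M.atoms, g.1 t = M.max t := by
  have hfin := M.finite_atoms (half_pos h)
  obtain ⟨g₀, hg₀, hlt⟩ := (lt_max_iff (half_pos h).le).1 (half_lt_self h)
  obtain ⟨g, ⟨hg, -⟩, hmax⟩ := Set.exists_max_image _ (fun f : C0 T => f.1 t) hfin
    ⟨g₀, hg₀, hlt.trans_le (g₀.apply_le_norm t)⟩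
  refine ⟨g, hg, le_antisymm (apply_le_max hg t) (max_le (g.2.1 t) fun f hf => ?_)⟩
  rcases lt_or_ge (M.max t / 2) ‖f.1‖ with h' | h'
  · exact hmax f ⟨hf, h'⟩
  · exact (f.apply_le_norm t).trans
      (h'.trans (hlt.le.trans (hmax g₀ ⟨hg₀, hlt.trans_le (g₀.apply_le_norm t)⟩)))

theorem measurable_max (t : T) : Measurable fun M : PointMeasure T => M.max t := by
  refine measurable_of_Ioi fun x => ?_
  rcases lt_or_ge x 0 with hx | hx
  · convert MeasurableSet.univ using 1
    exact eq_univ_of_forall fun M => hx.trans_le (M.max_nonneg t)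
  · have hs : MeasurableSet {f : C0 T | x < f.1 t} :=
      measurableSet_lt measurable_const (measurable_eval_C0 t)
    have : (fun M : PointMeasure T => M.max t) ⁻¹' Ioi x =
        {M | M.1 {f : C0 T | x < f.1 t} = 0}ᶜ := by
      ext M
      change x < M.max t ↔ ¬ M.1 {f : C0 T | x < f.1 t} = 0
      rw [apply_eq_zero_iff M hs, lt_max_iff hx]
      push Not
      rfl
    rw [this]
    exact ((measurable_apply hs) (measurableSet_singleton 0)).compl

variable (T) in
/-- The tautological kernel, sending a point measure to itself. -/
def kernel : Kernel (PointMeasure T) (C0 T) :=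
  ⟨Subtype.val, measurable_subtype_coe⟩

theorem kernel_apply (M : PointMeasure T) : kernel T M = M.1 := rfl

/-- A point measure has finite mass on each shell, but with no bound uniform in `M`. Splitting
further by the integer part of that mass yields countably many uniformly bounded kernels. -/
instance : IsSFiniteKernel (kernel T) := by
  have hsum : kernel T = Kernel.sum fun n => (kernel T).restrict (measurableSet_level n) := by
    ext M : 1
    rw [Kernel.sum_apply]
    simp only [Kernel.restrict_apply]
    rw [← Measure.restrict_iUnion pairwise_disjoint_level measurableSet_level, iUnion_level,
      Measure.restrict_univ]
  rw [hsum]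
  suffices h : ∀ n, IsSFiniteKernel ((kernel T).restrict (measurableSet_level n)) from
    Kernel.isSFiniteKernel_sum
  intro n
  have hm : ∀ m : ℕ, MeasurableSet {M : PointMeasure T | ⌊(M.1 (level T n)).toReal⌋₊ = m} :=
    fun m => (Nat.measurable_floor.comp
      (measurable_apply (measurableSet_level n)).ennreal_toReal) (measurableSet_singleton m)
  classical
  have hn : (kernel T).restrict (measurableSet_level n) = Kernel.sum fun m : ℕ =>
      Kernel.piecewise (hm m) ((kernel T).restrict (measurableSet_level n)) 0 := by
    ext M s hs
    rw [Kernel.sum_apply' _ _ hs, tsum_eq_single ⌊(M.1 (level T n)).toReal⌋₊]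
    · simp [Kernel.piecewise_apply']
    · intro m hne
      simp [Kernel.piecewise_apply', hne.symm]
  rw [hn]
  suffices h : ∀ m, IsFiniteKernel
      (Kernel.piecewise (hm m) ((kernel T).restrict (measurableSet_level n)) 0) from
    Kernel.isSFiniteKernel_sum
  intro m
  refine ⟨⟨m + 1, by finiteness, fun M => ?_⟩⟩
  rw [Kernel.piecewise_apply']
  split_ifs with h
  · rw [Kernel.restrict_apply, Measure.restrict_apply_univ, kernel_apply,
      ← ENNReal.ofReal_toReal (M.apply_level_lt_top n).ne]
    have h1 := Nat.lt_floor_add_one (M.1 (level T n)).toReal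
    rw [show ⌊(M.1 (level T n)).toReal⌋₊ = m from h] at h1
    refine ENNReal.ofReal_le_of_le_toReal ?_
    rw [ENNReal.toReal_add (by finiteness) (by finiteness)]
    simpa using h1.le
  · simp

theorem measurable_apply_prodMk {S : Set (PointMeasure T × C0 T)} (hS : MeasurableSet S) :
    Measurable fun M : PointMeasure T => M.1 {f | (M, f) ∈ S} :=
  Kernel.measurable_kernel_prodMk_left (κ := kernel T) hS

theorem measurable_restrict_prodMk {S : Set (PointMeasure T × C0 T)} (hS : MeasurableSet S) :
    Measurable fun M : PointMeasure T => M.restrict {f | (M, f) ∈ S} := by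
  refine measurable_of_apply fun s hs => ?_
  simp only [restrict, Measure.restrict_apply hs]
  exact measurable_apply_prodMk ((measurable_snd hs).inter hS)

theorem measurable_apply_comp_max (t : T) {R : Set (ℝ × ℝ)} (hR : MeasurableSet R) :
    Measurable fun M : PointMeasure T => M.1 {f | (f.1 t, M.max t) ∈ R} :=
  measurable_apply_prodMk (S := {p | (p.2.1 t, p.1.max t) ∈ R})
    ((((measurable_eval_C0 t).comp measurable_snd).prodMk
      ((measurable_max t).comp measurable_fst)) hR)

theorem measurable_subExtremal {k : ℕ} (t : Fin k → T) :
    Measurable fun M : PointMeasure T => M.subExtremal (range t) := by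
  refine measurable_restrict_prodMk (S := {p | LtOn (range t) p.2.1 p.1.max}) ?_
  have : {p : PointMeasure T × C0 T | LtOn (range t) p.2.1 p.1.max} =
      ⋂ i, {p | p.2.1 (t i) < p.1.max (t i)} := by
    ext p
    rw [mem_iInter]
    exact forall_mem_range
  rw [this]
  exact MeasurableSet.iInter fun i => measurableSet_lt
    ((measurable_eval_C0 (t i)).comp measurable_snd) ((measurable_max (t i)).comp measurable_fst)

theorem lintegral_pi_fin_succ {X : Type*} [MeasurableSpace X] (μ : Measure X) [SigmaFinite μ]
    {n : ℕ} {F : (Fin (n + 1) → X) → ℝ≥0∞} (hF : Measurable F) :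
    ∫⁻ f, F f ∂(Measure.pi fun _ => μ) =
      ∫⁻ g, ∫⁻ f, F (Fin.cons g f : Fin (n + 1) → X) ∂(Measure.pi fun _ => μ) ∂μ := by
  have h := (measurePreserving_piFinSuccAbove (fun _ : Fin (n + 1) => μ) 0).symm
  rw [← h.lintegral_comp hF, lintegral_prod (fun p => F ((MeasurableEquiv.piFinSuccAbove _ 0).symm p))
    (hF.comp h.measurable).aemeasurable]
  simp [MeasurableEquiv.piFinSuccAbove, Fin.insertNthEquiv]

theorem measurable_fin_cons {X : Type*} [MeasurableSpace X] {n : ℕ} :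
    Measurable fun p : X × (Fin n → X) => (Fin.cons p.1 p.2 : Fin (n + 1) → X) := by
  refine measurable_pi_lambda _ fun i => ?_
  refine Fin.cases ?_ (fun j => ?_) i
  · simpa using measurable_fst
  · exact (measurable_pi_apply j).comp measurable_snd

/-- The parameter space is arbitrary so that the induction can absorb the first coordinate into it.
It shares the universe of `T` so that `X × C0 T` stays admissible. -/
theorem measurable_lintegral_pi.{u} {T : Type u} [MetricSpace T] [CompactSpace T] (n : ℕ)
    {X : Type u} [MeasurableSpace X] {N : X → PointMeasure T}
    (hN : Measurable N) {F : X × (Fin n → C0 T) → ℝ≥0∞} (hF : Measurable F) :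
    Measurable fun x => ∫⁻ f, F (x, f) ∂(Measure.pi fun _ => (N x).1) := by
  induction n generalizing X with
  | zero =>
    simp only [Measure.pi_of_empty _ (Fin.elim0 : Fin 0 → C0 T)]
    have : ∀ x, ∫⁻ f, F (x, f) ∂(Measure.dirac (Fin.elim0 : Fin 0 → C0 T)) = F (x, Fin.elim0) :=
      fun x => lintegral_dirac' _ (hF.comp measurable_prodMk_left)
    simp only [this]
    exact hF.comp measurable_prodMk_right
  | succ n ih =>
    have h1 : ∀ x, ∫⁻ f, F (x, f) ∂(Measure.pi fun _ => (N x).1) =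
        ∫⁻ g, ∫⁻ f, F (x, Fin.cons g f) ∂(Measure.pi fun _ => (N x).1) ∂(N x).1 :=
      fun x => lintegral_pi_fin_succ _ (hF.comp measurable_prodMk_left)
    simp only [h1]
    have h2 := ih (X := X × C0 T) (N := fun p => N p.1) (hN.comp measurable_fst)
      (F := fun p => F (p.1.1, Fin.cons p.1.2 p.2))
      (hF.comp ((measurable_fst.comp measurable_fst).prodMk
        (measurable_fin_cons.comp ((measurable_snd.comp measurable_fst).prodMk measurable_snd))))
    exact h2.lintegral_kernel_prod_right' (κ := (kernel T).comap N hN)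

end PointMeasure

/-! ### Size-biasing of Poisson counts -/

theorem lintegral_mul_poisson (r : ℝ≥0) {h : ℝ≥0∞ → ℝ≥0∞} (hh : Measurable h) :
    ∫⁻ x, x * h x ∂((poissonMeasure r).map (fun n : ℕ => (n : ℝ≥0∞))) =
      r * ∫⁻ x, h (x + 1) ∂((poissonMeasure r).map (fun n : ℕ => (n : ℝ≥0∞))) := by
  rw [lintegral_map (by fun_prop) .of_discrete, lintegral_map (by fun_prop) .of_discrete,
    poissonMeasure, lintegral_sum_measure, lintegral_sum_measure]
  simp only [lintegral_smul_measure, lintegral_dirac, smul_eq_mul]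
  rw [tsum_eq_zero_add' ENNReal.summable, ← ENNReal.tsum_mul_left]
  simp only [Nat.cast_zero, zero_mul, mul_zero, zero_add]
  refine tsum_congr fun n => ?_
  have : ENNReal.ofReal (Real.exp (-r) * r ^ (n + 1) / (n + 1).factorial) * ((n + 1 : ℕ) : ℝ≥0∞) =
      r * ENNReal.ofReal (Real.exp (-r) * r ^ n / n.factorial) := by
    rw [← ENNReal.ofReal_natCast, ← ENNReal.ofReal_coe_nnreal, ← ENNReal.ofReal_mul (by positivity),
      ← ENNReal.ofReal_mul (by positivity), Nat.factorial_succ]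
    congr 1
    push_cast
    field_simp
    ring
  rw [← mul_assoc, this, mul_assoc]
  push_cast
  rfl

/-- Both sides integrate `g` against finite measures on `ι → ℝ≥0∞`, so boxes suffice. There
independence factorises both sides, and only the factor at `s` differs; `lintegral_mul_poisson`
treats it. -/
theorem lintegral_mul_of_iIndepFun_poisson {Ω ι : Type*} [MeasurableSpace Ω] [Fintype ι]
    [DecidableEq ι] {P : Measure Ω} {X : ι → Ω → ℝ≥0∞} (hX : iIndepFun X P)
    (hXm : ∀ i, Measurable (X i)) (r : ι → ℝ≥0)
    (hlaw : ∀ i, P.map (X i) = (poissonMeasure (r i)).map (fun n : ℕ => (n : ℝ≥0∞)))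
    (s : ι) {g : (ι → ℝ≥0∞) → ℝ≥0∞} (hg : Measurable g) :
    ∫⁻ ω, X s ω * g (fun i => X i ω) ∂P =
      r s * ∫⁻ ω, g (fun i => X i ω + if i = s then 1 else 0) ∂P := by
  have hP : IsProbabilityMeasure P := hX.isProbabilityMeasure
  have hXm' : Measurable fun ω i => X i ω := measurable_pi_lambda _ hXm
  have hXe : Measurable fun ω i => X i ω + if i = s then 1 else 0 :=
    measurable_pi_lambda _ fun i => (hXm i).add_const _
  have hwd : ∀ φ : Ω → ℝ≥0∞, Measurable φ →
      ∫⁻ ω, φ ω ∂(P.withDensity (X s)) = ∫⁻ ω, X s ω * φ ω ∂P :=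
    fun φ hφ => lintegral_withDensity_eq_lintegral_mul _ (hXm s) hφ
  have hone : ∀ i {h : ℝ≥0∞ → ℝ≥0∞}, Measurable h → ∫⁻ ω, h (X i ω) ∂P =
      ∫⁻ x, h x ∂((poissonMeasure (r i)).map (fun n : ℕ => (n : ℝ≥0∞))) := by
    intro i h hh
    rw [← hlaw i, lintegral_map hh (hXm i)]
  have hprod : ∀ h : ι → ℝ≥0∞ → ℝ≥0∞, (∀ i, Measurable (h i)) →
      ∫⁻ ω, ∏ i, h i (X i ω) ∂P = ∏ i, ∫⁻ ω, h i (X i ω) ∂P := fun h hh =>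
    lintegral_prod_eq_prod_lintegral_of_indepFun Finset.univ (fun i ω => h i (X i ω))
      (hX.comp h hh) fun i => (hh i).comp (hXm i)
  have hbox : ∀ S : ι → Set ℝ≥0∞, (∀ i, MeasurableSet (S i)) →
      ((P.withDensity (X s)).map fun ω i => X i ω) (univ.pi S) =
        ((r s : ℝ≥0∞) • P.map fun ω i => X i ω + if i = s then 1 else 0) (univ.pi S) := by
    intro S hS
    have hSm : MeasurableSet (univ.pi S) := MeasurableSet.univ_pi hS
    have hind : ∀ y : ι → ℝ≥0∞, (univ.pi S).indicator 1 y =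
        ∏ i, (S i).indicator (1 : ℝ≥0∞ → ℝ≥0∞) (y i) := by
      intro y
      by_cases hy : y ∈ univ.pi S
      · rw [indicator_of_mem hy, Finset.prod_eq_one]
        · rfl
        · intro i _
          rw [indicator_of_mem (hy i (mem_univ i))]
          rfl
      · rw [indicator_of_notMem hy]
        simp only [mem_univ_pi, not_forall] at hy
        obtain ⟨i, hi⟩ := hy
        exact (Finset.prod_eq_zero (Finset.mem_univ i) (indicator_of_notMem hi _)).symm
    have hSi : ∀ i, Measurable ((S i).indicator (1 : ℝ≥0∞ → ℝ≥0∞)) :=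
      fun i => measurable_one.indicator (hS i)
    have e1 : ((P.withDensity (X s)).map fun ω i => X i ω) (univ.pi S) =
        ∫⁻ ω, ∏ i, ((if i = s then X i ω else 1) * (S i).indicator 1 (X i ω)) ∂P := by
      rw [← lintegral_indicator_one hSm, lintegral_map (measurable_one.indicator hSm) hXm',
        hwd (fun ω => (univ.pi S).indicator 1 fun i => X i ω)
          ((measurable_one.indicator hSm).comp hXm')]
      refine lintegral_congr fun ω => ?_
      rw [hind, Finset.prod_mul_distrib, Finset.prod_ite_eq' Finset.univ s]
      simp
    have e2 : (P.map fun ω i => X i ω + if i = s then 1 else 0) (univ.pi S) =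
        ∫⁻ ω, ∏ i, (S i).indicator 1 (X i ω + if i = s then 1 else 0) ∂P := by
      rw [← lintegral_indicator_one hSm, lintegral_map (measurable_one.indicator hSm) hXe]
      exact lintegral_congr fun ω => hind _
    rw [Measure.smul_apply, e1, e2,
      hprod (fun i x => (if i = s then x else 1) * (S i).indicator 1 x) fun i => by
        refine Measurable.mul ?_ (hSi i)
        split_ifs <;> fun_prop,
      hprod (fun i x => (S i).indicator 1 (x + if i = s then 1 else 0)) fun i =>
        (hSi i).comp (measurable_id.add_const _),
      ← Finset.mul_prod_erase _ _ (Finset.mem_univ s),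
      ← Finset.mul_prod_erase (f := fun i => ∫⁻ ω, (S i).indicator 1
        (X i ω + if i = s then 1 else 0) ∂P) _ (Finset.mem_univ s), smul_eq_mul, ← mul_assoc]
    congr 1
    · simp only [if_true]
      rw [hone s (h := fun x => x * (S s).indicator 1 x) (measurable_id.mul (hSi s)),
        lintegral_mul_poisson _ (hSi s),
        ← hone s (h := fun x => (S s).indicator 1 (x + 1))
          ((hSi s).comp (measurable_id.add_const _))]
    · refine Finset.prod_congr rfl fun i hi => ?_
      simp [Finset.ne_of_mem_erase hi]
  have hmeas : ((P.withDensity (X s)).map fun ω i => X i ω) =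
      (r s : ℝ≥0∞) • P.map fun ω i => X i ω + if i = s then 1 else 0 := by
    have hfin : IsFiniteMeasure
        ((r s : ℝ≥0∞) • P.map fun ω i => X i ω + if i = s then 1 else 0) :=
      inferInstanceAs (IsFiniteMeasure (r s • P.map fun ω i => X i ω + if i = s then 1 else 0))
    symm
    refine ext_of_generate_finite _ generateFrom_pi.symm isPiSystem_pi ?_ ?_
    · rintro _ ⟨S, hS, rfl⟩
      exact (hbox S fun i => hS i (mem_univ i)).symm
    · have := hbox (fun _ => univ) fun _ => MeasurableSet.univ
      rw [pi_univ] at this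
      exact this.symm
  have := congrArg (fun ν => ∫⁻ y, g y ∂ν) hmeas
  simp only [lintegral_smul_measure, lintegral_map hg hXm', lintegral_map hg hXe] at this
  rw [hwd (fun ω => g fun i => X i ω) (hg.comp hXm')] at this
  exact this

open PointMeasure

/-! ### Decomposition of finitely many sets into disjoint cells -/

section Cells

variable {ι X : Type*}

/-- The points that belong to exactly those sets of the family `A` whose index lies in `σ`. -/
def cell (A : ι → Set X) (σ : Finset ι) : Set X :=
  {x | ∀ i, x ∈ A i ↔ i ∈ σ}

theorem pairwise_disjoint_cell (A : ι → Set X) : Pairwise (Function.onFun Disjoint (cell A)) := by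
  intro σ σ' h
  refine Set.disjoint_left.2 fun x hx hx' => h ?_
  ext i
  exact (hx i).symm.trans (hx' i)

theorem measurableSet_cell [MeasurableSpace X] [Countable ι] {A : ι → Set X}
    (hA : ∀ i, MeasurableSet (A i)) (σ : Finset ι) : MeasurableSet (cell A σ) := by
  have : cell A σ = ⋂ i, {x | x ∈ A i ↔ i ∈ σ} := by
    ext x
    simp [cell]
  rw [this]
  refine MeasurableSet.iInter fun i => ?_
  by_cases hi : i ∈ σ
  · simpa [hi] using hA i
  · simp only [hi, iff_false]
    exact (hA i).compl

/-- The empty index set is left out: its cell is the complement of all the `A i`, which may have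
infinite intensity. -/
theorem biUnion_cell [Fintype ι] [DecidableEq ι] (A : ι → Set X) (i : ι) :
    A i = ⋃ σ ∈ (Finset.univ : Finset {σ : Finset ι // σ.Nonempty}).filter (fun σ => i ∈ σ.1),
      cell A σ.1 := by
  classical
  ext x
  simp only [mem_iUnion, Finset.mem_filter, Finset.mem_univ, true_and]
  constructor
  · intro hx
    exact ⟨⟨Finset.univ.filter fun j => x ∈ A j, i, by simpa using hx⟩, by simpa using hx,
      fun j => by simp⟩
  · rintro ⟨σ, hi, hx⟩
    exact (hx i).2 hi

theorem measure_eq_sum_cell [MeasurableSpace X] [Fintype ι] [DecidableEq ι] {A : ι → Set X}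
    (hA : ∀ i, MeasurableSet (A i)) (N : Measure X) (i : ι) :
    N (A i) = ∑ σ : {σ : Finset ι // σ.Nonempty}, if i ∈ σ.1 then N (cell A σ.1) else 0 := by
  conv_lhs => rw [biUnion_cell A i]
  rw [measure_biUnion_finset, Finset.sum_filter]
  · intro σ _ σ' _ h
    exact pairwise_disjoint_cell A fun h' => h (Subtype.ext h')
  · exact fun σ _ => measurableSet_cell hA _

end Cells

/-! ### Generating π-systems built from subsets of shells -/

theorem generateFrom_subset_level :
    MeasurableSpace.generateFrom {D : Set (C0 T) | MeasurableSet D ∧ ∃ n, D ⊆ level T n} =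
      instMeasurableSpaceC0 := by
  refine le_antisymm (MeasurableSpace.generateFrom_le fun D hD => hD.1) fun D hD => ?_
  rw [← inter_univ D, ← iUnion_level, inter_iUnion]
  exact MeasurableSet.iUnion fun n => MeasurableSpace.measurableSet_generateFrom
    ⟨MeasurableSet.inter hD (measurableSet_level n), n, inter_subset_right⟩

/-- The σ-algebra on point measures generated by the mass of `D`. -/
abbrev massSpace (D : Set (C0 T)) : MeasurableSpace (PointMeasure T) :=
  MeasurableSpace.comap (fun M : PointMeasure T => M.1 D) inferInstance

variable (T) in
/-- The cylinder sets of point measures that only involve the masses of finitely many Borel sets,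
each of them contained in some `level T n`. -/
def cylinders : Set (Set (PointMeasure T)) :=
  piiUnionInter (fun D : Set (C0 T) => {E | MeasurableSet[massSpace D] E})
    {D | MeasurableSet D ∧ ∃ n, D ⊆ level T n}

theorem isPiSystem_cylinders : IsPiSystem (cylinders T) :=
  isPiSystem_piiUnionInter _
    (fun D => @MeasurableSpace.isPiSystem_measurableSet _ (massSpace D)) _

/-- The mass of any Borel set is the sum of its masses on the shells, so sets inside a single shell
already generate. -/
theorem generateFrom_cylinders :
    Subtype.instMeasurableSpace = MeasurableSpace.generateFrom (cylinders T) := by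
  refine Eq.trans ?_ (generateFrom_piiUnionInter_measurableSet
    (fun D : Set (C0 T) => massSpace D) {D | MeasurableSet D ∧ ∃ n, D ⊆ level T n}).symm
  refine le_antisymm ?_ (iSup₂_le fun D hD => (measurable_apply hD.1).comap_le)
  set m : MeasurableSpace (PointMeasure T) :=
    ⨆ D ∈ {D : Set (C0 T) | MeasurableSet D ∧ ∃ n, D ⊆ level T n},
      massSpace D with hm
  have hD : ∀ D : Set (C0 T), MeasurableSet D → (∃ n, D ⊆ level T n) →
      Measurable[m] fun M : PointMeasure T => M.1 D := by
    intro D h1 h2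
    rw [measurable_iff_comap_le]
    exact le_iSup₂ (f := fun D (_ : D ∈ {D : Set (C0 T) | MeasurableSet D ∧ ∃ n, D ⊆ level T n}) =>
      massSpace D) D ⟨h1, h2⟩
  have hid : @Measurable _ _ m Subtype.instMeasurableSpace
      (id : PointMeasure T → PointMeasure T) := by
    refine @measurable_of_apply T _ _ _ m _ fun s hs => ?_
    have : (fun M : PointMeasure T => M.1 s) = fun M => ∑' n, M.1 (s ∩ level T n) := by
      ext M
      rw [← measure_iUnion, ← inter_iUnion, iUnion_level, inter_univ]
      · exact fun i j h => (pairwise_disjoint_level h).mono inter_subset_right inter_subset_right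
      · exact fun n => hs.inter (measurableSet_level n)
    change Measurable[m] fun M : PointMeasure T => M.1 s
    rw [this]
    refine Measurable.tsum fun n =>
      hD _ (hs.inter (measurableSet_level n)) ⟨n, inter_subset_right⟩
  exact fun s hs => hid hs

/-! ### Mecke's formula for one point -/

namespace IsPoissonRandomMeasure

variable {Ω : Type*} [MeasurableSpace Ω] {P : Measure Ω}
  {μ : Measure (C0 T)} {Φ : Ω → PointMeasure T} (hΦ : IsPoissonRandomMeasure P μ Φ)
include hΦ

theorem measurable_apply {s : Set (C0 T)} (hs : MeasurableSet s) :
    Measurable fun ω => (Φ ω).1 s :=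
  (PointMeasure.measurable_apply hs).comp hΦ.measurable

theorem measurable_addDirac : Measurable fun p : Ω × C0 T => (Φ p.1).addDirac p.2 :=
  PointMeasure.measurable_addDirac.comp
    ((hΦ.measurable.comp measurable_fst).prodMk measurable_snd)

/-- A point added in `C s` raises the count of `C s` by one and no other, so the inner integral on
the right is constant on `C s` and size-biasing applies. -/
theorem mecke_of_disjoint {ι : Type*} [Fintype ι] {C : ι → Set (C0 T)}
    (hC : ∀ i, MeasurableSet (C i)) (hd : Pairwise (Function.onFun Disjoint C))
    (hfin : ∀ i, μ (C i) ≠ ∞) (s : ι) {g : (ι → ℝ≥0∞) → ℝ≥0∞} (hg : Measurable g) :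
    ∫⁻ ω, (Φ ω).1 (C s) * g (fun i => (Φ ω).1 (C i)) ∂P =
      ∫⁻ f in C s, ∫⁻ ω, g (fun i => ((Φ ω).addDirac f).1 (C i)) ∂P ∂μ := by
  classical
  have hind : iIndepFun (fun i ω => (Φ ω).1 (C i)) P := by
    let e := Fintype.equivFin ι
    have h := hΦ.indep _ (fun j => C (e.symm j)) (fun j => hC _)
      (fun i j hij => hd (e.symm.injective.ne hij))
    simpa using h.precomp e.injective
  rw [lintegral_mul_of_iIndepFun_poisson hind (fun i => hΦ.measurable_apply (hC i))
    (fun i => (μ (C i)).toNNReal) (fun i => hΦ.law_of_finite _ (hC i) (hfin i)) s hg,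
    setLIntegral_congr_fun (g := fun _ => ∫⁻ ω, g (fun i => (Φ ω).1 (C i) +
      if i = s then 1 else 0) ∂P) (hC s), setLIntegral_const, mul_comm,
    ENNReal.coe_toNNReal (hfin s)]
  intro f hf
  refine lintegral_congr fun ω => congrArg g (funext fun i => ?_)
  rw [addDirac, Measure.add_apply, Measure.dirac_apply' _ (hC i)]
  congr 1
  by_cases his : i = s
  · subst his
    simp [hf]
  · rw [if_neg his, indicator_of_notMem]
    exact fun hfi => Set.disjoint_left.1 (hd his) hfi hf

/-- Every count is a sum of counts of disjoint cells, so the disjoint case applies to each cell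
inside `A s`, and the results add up. -/
theorem mecke_of_finite {ι : Type*} [Fintype ι] {A : ι → Set (C0 T)}
    (hA : ∀ i, MeasurableSet (A i)) (hfin : ∀ i, μ (A i) ≠ ∞) (s : ι)
    {g : (ι → ℝ≥0∞) → ℝ≥0∞} (hg : Measurable g) :
    ∫⁻ ω, (Φ ω).1 (A s) * g (fun i => (Φ ω).1 (A i)) ∂P =
      ∫⁻ f in A s, ∫⁻ ω, g (fun i => ((Φ ω).addDirac f).1 (A i)) ∂P ∂μ := by
  classical
  let L : ({σ : Finset ι // σ.Nonempty} → ℝ≥0∞) → ι → ℝ≥0∞ :=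
    fun x i => ∑ σ : {σ : Finset ι // σ.Nonempty}, if i ∈ σ.1 then x σ else 0
  have hL : Measurable L := by
    refine measurable_pi_lambda _ fun i => Finset.measurable_sum _ fun σ _ => ?_
    split_ifs
    · exact measurable_pi_apply σ
    · exact measurable_const
  have hLA : ∀ N : Measure (C0 T), (fun i => N (A i)) = L fun σ => N (cell A σ.1) :=
    fun N => funext fun i => measure_eq_sum_cell hA N i
  have hcm : ∀ σ : {σ : Finset ι // σ.Nonempty}, MeasurableSet (cell A σ.1) :=
    fun σ => measurableSet_cell hA _
  have hcd : Pairwise (Function.onFun Disjoint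
      fun σ : {σ : Finset ι // σ.Nonempty} => cell A σ.1) :=
    fun σ σ' h => pairwise_disjoint_cell A fun h' => h (Subtype.ext h')
  have hcf : ∀ σ : {σ : Finset ι // σ.Nonempty}, μ (cell A σ.1) ≠ ∞ := by
    rintro ⟨σ, i, hi⟩
    exact measure_ne_top_of_subset (fun x hx => (hx i).2 hi) (hfin i)
  have key : ∀ σ, _ := fun σ => hΦ.mecke_of_disjoint hcm hcd hcf σ (hg.comp hL)
  simp only [Function.comp_apply, ← hLA] at key
  have hunion := biUnion_cell A s
  calc ∫⁻ ω, (Φ ω).1 (A s) * g (fun i => (Φ ω).1 (A i)) ∂P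
      = ∫⁻ ω, ∑ σ ∈ (Finset.univ : Finset {σ : Finset ι // σ.Nonempty}).filter
          (fun σ => s ∈ σ.1), (Φ ω).1 (cell A σ.1) * g (fun i => (Φ ω).1 (A i)) ∂P := by
        refine lintegral_congr fun ω => ?_
        rw [← Finset.sum_mul, Finset.sum_filter, ← measure_eq_sum_cell hA]
    _ = ∑ σ ∈ (Finset.univ : Finset {σ : Finset ι // σ.Nonempty}).filter
          (fun σ => s ∈ σ.1), ∫⁻ f in cell A σ.1,
            ∫⁻ ω, g (fun i => ((Φ ω).addDirac f).1 (A i)) ∂P ∂μ := by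
        rw [lintegral_finsetSum]
        · exact Finset.sum_congr rfl fun σ _ => key σ
        · intro σ _
          exact (hΦ.measurable_apply (hcm σ)).mul
            (hg.comp (measurable_pi_lambda _ fun i => hΦ.measurable_apply (hA i)))
    _ = _ := by
        conv_rhs => rw [hunion]
        rw [lintegral_biUnion_finset]
        · exact fun σ _ σ' _ h => hcd h
        · exact fun σ _ => hcm σ

variable [IsProbabilityMeasure P]

/-- Infinite intensity would force infinite mass almost surely, which no point measure has on this
set. -/
theorem intensity_ne_top {ε : ℝ} (hε : 0 < ε) : μ {f | ε < ‖f.1‖} ≠ ∞ := by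
  intro h
  have := hΦ.ae_eq_top _ (measurableSet_lt measurable_const measurable_norm_C0) h
  obtain ⟨ω, hω⟩ := this.exists
  exact ((Φ ω).apply_lt_top hε).ne hω

theorem intensity_level_ne_top (n : ℕ) : μ (level T n) ≠ ∞ :=
  measure_ne_top_of_subset (level_subset n) (hΦ.intensity_ne_top (by positivity))

theorem sigmaFinite : SigmaFinite μ :=
  ⟨⟨{ set := level T
      set_mem := fun _ => trivial
      finite := fun n => (hΦ.intensity_level_ne_top n).lt_top
      spanning := iUnion_level }⟩⟩

theorem mecke_cylinder {D : Set (C0 T)} (hD : MeasurableSet D) {n : ℕ} (hDn : D ⊆ level T n)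
    {E : Set (PointMeasure T)} (hE : E ∈ cylinders T) :
    ∫⁻ ω, (Φ ω).1 D * E.indicator 1 (Φ ω) ∂P =
      ∫⁻ f in D, ∫⁻ ω, E.indicator 1 ((Φ ω).addDirac f) ∂P ∂μ := by
  classical
  obtain ⟨s, hs, e, he, rfl⟩ := hE
  choose! S hS hSe using he
  -- The index `none` carries the set `D` that receives the new point; the others carry the sets
  -- defining the cylinder.
  let A : Option s → Set (C0 T) := fun o => o.elim D fun x => x.1
  have hfin : ∀ D : Set (C0 T), (∃ n, D ⊆ level T n) → μ D ≠ ∞ := fun D ⟨n, h⟩ =>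
    measure_ne_top_of_subset h (hΦ.intensity_level_ne_top n)
  have hU : MeasurableSet {y : Option s → ℝ≥0∞ | ∀ x : s, y (some x) ∈ S x.1} := by
    have : {y : Option s → ℝ≥0∞ | ∀ x : s, y (some x) ∈ S x.1} =
        ⋂ x : s, (fun y => y (some x)) ⁻¹' S x.1 := by
      ext y
      simp
    rw [this]
    exact MeasurableSet.iInter fun x => (measurable_pi_apply _) (hS x.1 x.2)
  have h := hΦ.mecke_of_finite (A := A)
    (by rintro (_ | x); exacts [hD, (hs x.2).1])
    (by rintro (_ | x); exacts [hfin _ ⟨n, hDn⟩, hfin _ (hs x.2).2])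
    none (measurable_one.indicator hU)
  have hind : ∀ M : PointMeasure T,
      {y : Option s → ℝ≥0∞ | ∀ x : s, y (some x) ∈ S x.1}.indicator
        (1 : (Option s → ℝ≥0∞) → ℝ≥0∞) (fun i => M.1 (A i)) = (⋂ x ∈ s, e x).indicator 1 M := by
    intro M
    have : (fun i => M.1 (A i)) ∈ {y : Option s → ℝ≥0∞ | ∀ x : s, y (some x) ∈ S x.1} ↔
        M ∈ ⋂ x ∈ s, e x := by
      rw [mem_iInter₂]
      constructor
      · intro H x hx
        rw [← hSe x hx]
        exact H ⟨x, hx⟩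
      · rintro H ⟨x, hx⟩
        have := H x hx
        rw [← hSe x hx] at this
        exact this
    by_cases hM : M ∈ ⋂ x ∈ s, e x
    · rw [indicator_of_mem hM, indicator_of_mem (this.2 hM)]
      rfl
    · rw [indicator_of_notMem hM, indicator_of_notMem (mt this.1 hM)]
  simp only [hind] at h
  exact h

/-- As functions of `E` both sides are measures of total mass `μ D < ∞` that agree on the π-system
of cylinders. -/
theorem mecke_rectangle {D : Set (C0 T)} (hD : MeasurableSet D) {n : ℕ} (hDn : D ⊆ level T n)
    {E : Set (PointMeasure T)} (hE : MeasurableSet E) :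
    ∫⁻ ω, (Φ ω).1 D * E.indicator 1 (Φ ω) ∂P =
      ∫⁻ f in D, ∫⁻ ω, E.indicator 1 ((Φ ω).addDirac f) ∂P ∂μ := by
  have hσ := hΦ.sigmaFinite
  let ν₁ : Measure (PointMeasure T) := (P.withDensity fun ω => (Φ ω).1 D).map Φ
  let ν₂ : Measure (PointMeasure T) :=
    (P.prod (μ.restrict D)).map fun p => (Φ p.1).addDirac p.2
  have e₁ : ∀ E, MeasurableSet E → ν₁ E = ∫⁻ ω, (Φ ω).1 D * E.indicator 1 (Φ ω) ∂P := by
    intro E hE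
    rw [← lintegral_indicator_one hE, lintegral_map (measurable_one.indicator hE) hΦ.measurable]
    exact lintegral_withDensity_eq_lintegral_mul _ (hΦ.measurable_apply hD)
      ((measurable_one.indicator hE).comp hΦ.measurable)
  have e₂ : ∀ E, MeasurableSet E →
      ν₂ E = ∫⁻ f in D, ∫⁻ ω, E.indicator 1 ((Φ ω).addDirac f) ∂P ∂μ := by
    intro E hE
    have hm := ((measurable_one (α := ℝ≥0∞)).indicator hE).comp hΦ.measurable_addDirac
    rw [← lintegral_indicator_one hE,
      lintegral_map (measurable_one.indicator hE) hΦ.measurable_addDirac]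
    exact lintegral_prod_symm _ hm.aemeasurable
  have huniv : (univ : Set (PointMeasure T)) ∈ cylinders T :=
    ⟨∅, by simp, fun _ => univ, by simp, by simp⟩
  have hmeas : ∀ E ∈ cylinders T, MeasurableSet E := by
    intro E hE
    have := MeasurableSpace.measurableSet_generateFrom hE
    rwa [← generateFrom_cylinders] at this
  have hcyl : ∀ E ∈ cylinders T, ν₁ E = ν₂ E := fun E hE => by
    rw [e₁ E (hmeas E hE), e₂ E (hmeas E hE), hΦ.mecke_cylinder hD hDn hE]
  have hfin : IsFiniteMeasure ν₁ := by
    refine ⟨?_⟩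
    rw [hcyl _ huniv, e₂ _ MeasurableSet.univ]
    simpa using (measure_ne_top_of_subset hDn (hΦ.intensity_level_ne_top n)).lt_top
  have := ext_of_generate_finite _ generateFrom_cylinders isPiSystem_cylinders hcyl
    (hcyl _ huniv)
  rw [← e₁ E hE, ← e₂ E hE, this]

/-- **Mecke's formula** for Poisson random measures. -/
theorem mecke {F : PointMeasure T × C0 T → ℝ≥0∞} (hF : Measurable F) :
    ∫⁻ ω, ∫⁻ f, F (Φ ω, f) ∂(Φ ω).1 ∂P = ∫⁻ f, ∫⁻ ω, F ((Φ ω).addDirac f, f) ∂P ∂μ := by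
  have hσ := hΦ.sigmaFinite
  have : IsProbabilityMeasure (P.map Φ) := Measure.isProbabilityMeasure_map
    hΦ.measurable.aemeasurable
  let ν₁ : Measure (PointMeasure T × C0 T) := (P.map Φ).compProd (kernel T)
  have ha : Measurable fun p : Ω × C0 T => ((Φ p.1).addDirac p.2, p.2) :=
    hΦ.measurable_addDirac.prodMk measurable_snd
  let ν₂ : Measure (PointMeasure T × C0 T) :=
    (P.prod μ).map fun p => ((Φ p.1).addDirac p.2, p.2)
  have e₁ : ∀ F : PointMeasure T × C0 T → ℝ≥0∞, Measurable F →
      ∫⁻ p, F p ∂ν₁ = ∫⁻ ω, ∫⁻ f, F (Φ ω, f) ∂(Φ ω).1 ∂P := by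
    intro F hF
    rw [Measure.lintegral_compProd hF,
      lintegral_map (hF.lintegral_kernel_prod_right' (κ := kernel T)) hΦ.measurable]
    rfl
  have e₂ : ∀ F : PointMeasure T × C0 T → ℝ≥0∞, Measurable F →
      ∫⁻ p, F p ∂ν₂ = ∫⁻ f, ∫⁻ ω, F ((Φ ω).addDirac f, f) ∂P ∂μ := by
    intro F hF
    rw [lintegral_map hF ha]
    exact lintegral_prod_symm _ (hF.comp ha).aemeasurable
  suffices h : ν₁ = ν₂ by rw [← e₁ F hF, ← e₂ F hF, h]
  have hrect : ∀ E, MeasurableSet E → ∀ D, MeasurableSet D → (∃ n, D ⊆ level T n) →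
      ν₁ (E ×ˢ D) = ν₂ (E ×ˢ D) := by
    rintro E hE D hD ⟨n, hDn⟩
    have hI : ∀ p : PointMeasure T × C0 T, (E ×ˢ D).indicator (1 : PointMeasure T × C0 T → ℝ≥0∞) p =
        D.indicator 1 p.2 * E.indicator 1 p.1 := by
      rintro ⟨M, f⟩
      by_cases h1 : M ∈ E <;> by_cases h2 : f ∈ D <;> simp [h1, h2]
    have hm := (measurable_one (α := ℝ≥0∞)).indicator (hE.prod hD)
    rw [← lintegral_indicator_one (hE.prod hD), ← lintegral_indicator_one (hE.prod hD),
      e₁ _ hm, e₂ _ hm]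
    simp only [hI]
    refine Eq.trans (lintegral_congr fun ω => ?_) ((hΦ.mecke_rectangle hD hDn hE).trans ?_)
    · rw [lintegral_mul_const _ (measurable_one.indicator hD), lintegral_indicator_one hD]
    · rw [← lintegral_indicator hD]
      refine lintegral_congr fun f => ?_
      by_cases hf : f ∈ D <;> simp [hf]
  have hspan : IsCountablySpanning {D : Set (C0 T) | MeasurableSet D ∧ ∃ n, D ⊆ level T n} :=
    ⟨level T, fun n => ⟨measurableSet_level n, n, Subset.rfl⟩, iUnion_level⟩
  -- Rectangles with second side inside a shell form a generating π-system, and the strips `univ ×ˢ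
  -- level T n` cover the space with finite mass.
  refine Measure.ext_of_generateFrom_of_iUnion
    (image2 (· ×ˢ ·) {E : Set (PointMeasure T) | MeasurableSet E}
      {D : Set (C0 T) | MeasurableSet D ∧ ∃ n, D ⊆ level T n}) (fun n => univ ×ˢ level T n)
    (generateFrom_eq_prod MeasurableSpace.generateFrom_measurableSet generateFrom_subset_level
      isCountablySpanning_measurableSet hspan).symm
    (MeasurableSpace.isPiSystem_measurableSet.prod ?_) ?_ ?_ ?_ ?_
  · rintro D ⟨hD, n, hn⟩ D' ⟨hD', -⟩ -
    exact ⟨hD.inter hD', n, inter_subset_left.trans hn⟩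
  · rw [← prod_iUnion, iUnion_level, univ_prod_univ]
  · exact fun n => mem_image2_of_mem (mem_ofPred_eq ▸ MeasurableSet.univ)
      ⟨measurableSet_level n, n, Subset.rfl⟩
  · intro n
    rw [hrect _ MeasurableSet.univ _ (measurableSet_level n) ⟨n, Subset.rfl⟩,
      Measure.map_apply ha (MeasurableSet.univ.prod (measurableSet_level n))]
    have : (fun p : Ω × C0 T => ((Φ p.1).addDirac p.2, p.2)) ⁻¹' (univ ×ˢ level T n) =
        univ ×ˢ level T n := by
      ext p
      simp
    rw [this, Measure.prod_prod, measure_univ, one_mul]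
    exact hΦ.intensity_level_ne_top n
  · rintro _ ⟨E, hE, D, ⟨hD, hn⟩, rfl⟩
    exact hrect E hE D hD hn

end IsPoissonRandomMeasure

/-! ### Several points, and almost sure regularity -/

theorem lintegral_pi_addDirac {T : Type*} [MetricSpace T] [CompactSpace T]
    (M : PointMeasure T) (g : C0 T) {n : ℕ} {H : (Fin n → C0 T) → ℝ≥0∞}
    (h0 : ∀ f j, f j = g → H f = 0) :
    ∫⁻ f, H f ∂(Measure.pi fun _ => (M.addDirac g).1) = ∫⁻ f, H f ∂(Measure.pi fun _ => M.1) := by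
  have hsupp : Function.support H ⊆ univ.pi fun _ : Fin n => ({g}ᶜ : Set (C0 T)) := by
    intro f hf j _ hj
    exact hf (h0 f j hj)
  have hres : (M.addDirac g).1.restrict {g}ᶜ = M.1.restrict {g}ᶜ := by
    have : (Measure.dirac g).restrict ({g}ᶜ : Set (C0 T)) = 0 := by
      rw [Measure.restrict_eq_zero, Measure.dirac_apply' _ (measurableSet_singleton g).compl]
      simp
    rw [addDirac, Measure.restrict_add, this, add_zero]
  rw [← setLIntegral_eq_of_support_subset hsupp, Measure.restrict_pi_pi,
    ← setLIntegral_eq_of_support_subset (μ := Measure.pi fun _ => M.1) hsupp,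
    Measure.restrict_pi_pi, hres]

namespace IsPoissonRandomMeasure

variable {Ω : Type*} [MeasurableSpace Ω] {P : Measure Ω}
  {μ : Measure (C0 T)} {Φ : Ω → PointMeasure T} (hΦ : IsPoissonRandomMeasure P μ Φ)
include hΦ

/-- The functions positive at `t` have infinite intensity, so almost surely some atom is among them.
-/
theorem ae_max_pos {t : T} (ht : Tendsto (tail μ t) (𝓝[>] 0) (𝓝 ∞)) :
    ∀ᵐ ω ∂P, 0 < (Φ ω).max t := by
  have hm : MeasurableSet {f : C0 T | 0 < f.1 t} :=
    measurableSet_lt measurable_const (measurable_eval_C0 t)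
  have htop : μ {f | 0 < f.1 t} = ∞ := by
    refine top_le_iff.1 (le_of_tendsto ht ?_)
    exact eventually_nhdsWithin_of_forall fun y hy => measure_mono fun f hf =>
      show 0 < f.1 t from lt_of_lt_of_le hy hf
  filter_upwards [hΦ.ae_eq_top _ hm htop] with ω hω
  rw [lt_max_iff le_rfl]
  by_contra! H
  have : (Φ ω).1 {f | 0 < f.1 t} = 0 :=
    (apply_eq_zero_iff _ hm).2 fun g hg hg' => absurd (H g hg) (not_le.2 hg')
  simp [this] at hω

variable [IsProbabilityMeasure P]

/-- The multivariate **Mecke formula**, for functions that vanish off the tuples of distinct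
points. -/
theorem mecke_pi {n : ℕ} {F : PointMeasure T × (Fin n → C0 T) → ℝ≥0∞} (hF : Measurable F)
    (h0 : ∀ M f, ¬ Function.Injective f → F (M, f) = 0) :
    ∫⁻ ω, ∫⁻ f, F (Φ ω, f) ∂(Measure.pi fun _ => (Φ ω).1) ∂P =
      ∫⁻ f, ∫⁻ ω, F ((Φ ω).addDiracs f, f) ∂P ∂(Measure.pi fun _ => μ) := by
  have hσ := hΦ.sigmaFinite
  induction n with
  | zero =>
    simp only [Measure.pi_of_empty _ (Fin.elim0 : Fin 0 → C0 T)]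
    rw [lintegral_dirac]
    refine lintegral_congr fun ω => ?_
    rw [lintegral_dirac, addDiracs_zero]
  | succ n ih =>
    have hcons : Measurable fun p : (PointMeasure T × C0 T) × (Fin n → C0 T) =>
        (Fin.cons p.1.2 p.2 : Fin (n + 1) → C0 T) :=
      measurable_fin_cons.comp ((measurable_snd.comp measurable_fst).prodMk measurable_snd)
    have hG : Measurable fun p : PointMeasure T × C0 T =>
        ∫⁻ f, F (p.1, (Fin.cons p.2 f : Fin (n + 1) → C0 T)) ∂(Measure.pi fun _ => p.1.1) :=
      measurable_lintegral_pi n (X := PointMeasure T × C0 T) (N := fun p => p.1) measurable_fst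
        (F := fun p => F (p.1.1, Fin.cons p.1.2 p.2))
        (hF.comp ((measurable_fst.comp measurable_fst).prodMk hcons))
    have hI : Measurable fun f : Fin (n + 1) → C0 T => ∫⁻ ω, F ((Φ ω).addDiracs f, f) ∂P := by
      refine Measurable.lintegral_prod_right'
        (f := fun p : (Fin (n + 1) → C0 T) × Ω => F ((Φ p.2).addDiracs p.1, p.1)) ?_
      exact hF.comp ((measurable_addDiracs.comp
        ((hΦ.measurable.comp measurable_snd).prodMk measurable_fst)).prodMk measurable_fst)
    calc ∫⁻ ω, ∫⁻ f, F (Φ ω, f) ∂(Measure.pi fun _ => (Φ ω).1) ∂P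
        = ∫⁻ ω, ∫⁻ g, ∫⁻ f, F (Φ ω, (Fin.cons g f : Fin (n + 1) → C0 T))
            ∂(Measure.pi fun _ => (Φ ω).1) ∂(Φ ω).1 ∂P :=
          lintegral_congr fun ω => lintegral_pi_fin_succ _ (hF.comp measurable_prodMk_left)
      _ = ∫⁻ g, ∫⁻ ω, ∫⁻ f, F ((Φ ω).addDirac g, (Fin.cons g f : Fin (n + 1) → C0 T))
            ∂(Measure.pi fun _ => ((Φ ω).addDirac g).1) ∂P ∂μ := hΦ.mecke hG
      _ = ∫⁻ g, ∫⁻ f, ∫⁻ ω, F ((Φ ω).addDiracs (Fin.cons g f : Fin (n + 1) → C0 T),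
            (Fin.cons g f : Fin (n + 1) → C0 T)) ∂P ∂(Measure.pi fun _ => μ) ∂μ := by
          refine lintegral_congr fun g => ?_
          -- After the one-point formula the remaining coordinates still range over `Φ + δ_g`.
          -- Vanishing at tuples that contain `g` removes the extra atom, and vanishing at
          -- non-injective tuples is what the induction needs.
          have h0' : ∀ M (f : Fin n → C0 T), (¬ Function.Injective f ∨ ∃ j, f j = g) →
              F (M, (Fin.cons g f : Fin (n + 1) → C0 T)) = 0 := by
            intro M f h
            refine h0 _ _ fun hinj => ?_
            rw [Fin.cons_injective_iff] at hinj
            rcases h with h | ⟨j, hj⟩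
            · exact h hinj.2
            · exact hinj.1 ⟨j, hj⟩
          have h1 := ih (F := fun p => F (p.1.addDirac g, (Fin.cons g p.2 : Fin (n + 1) → C0 T)))
            (hF.comp ((PointMeasure.measurable_addDirac.comp
              (measurable_fst.prodMk measurable_const)).prodMk
                (measurable_fin_cons.comp (measurable_const.prodMk measurable_snd))))
            fun M f h => h0' _ f (Or.inl h)
          simp only [addDiracs_cons]
          rw [← h1]
          exact lintegral_congr fun ω => lintegral_pi_addDirac _ _ fun f j hj =>
            h0' _ f (Or.inr ⟨j, hj⟩)
      _ = _ := (lintegral_pi_fin_succ μ hI).symm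

theorem lintegral_apply {A : Set (C0 T)} (hA : MeasurableSet A) :
    ∫⁻ ω, (Φ ω).1 A ∂P = μ A := by
  have h := hΦ.mecke (F := fun p => A.indicator 1 p.2)
    ((measurable_one.indicator hA).comp measurable_snd)
  simpa [lintegral_indicator_one hA] using h

theorem ae_apply_eq_zero {A : Set (C0 T)} (hA : MeasurableSet A) (h : μ A = 0) :
    ∀ᵐ ω ∂P, (Φ ω).1 A = 0 := by
  have := hΦ.lintegral_apply hA
  rw [h, lintegral_eq_zero_iff (hΦ.measurable_apply hA)] at this
  exact this

/-- For `y > x` the level set at `x` and the tail at `y` are disjoint inside the tail at `x`. Let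
`y` decrease to `x` and cancel the tail at `x`, which is finite. -/
theorem intensity_eq_zero_of_continuousOn_tail {t : T} (hc : ContinuousOn (tail μ t) (Ioi 0))
    {x : ℝ} (hx : 0 < x) : μ {f | f.1 t = x} = 0 := by
  have hlt : tail μ t x ≠ ∞ := by
    refine measure_ne_top_of_subset (fun f hf => ?_) (hΦ.intensity_ne_top (half_pos hx))
    exact (half_lt_self hx).trans_le (le_trans hf (f.apply_le_norm t))
  have hle : ∀ y, x < y → μ {f | f.1 t = x} + tail μ t y ≤ tail μ t x := by
    intro y hy
    rw [tail, tail, ← measure_union]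
    · refine measure_mono ?_
      rintro f (hf | hf)
      · exact (show f.1 t = x from hf).ge
      · exact hy.le.trans hf
    · refine Set.disjoint_left.2 fun f hf hf' => ?_
      have h1 : f.1 t = x := hf
      have h2 : y ≤ f.1 t := hf'
      linarith
    · exact measurableSet_le measurable_const (measurable_eval_C0 t)
  have htend : Tendsto (tail μ t) (𝓝[>] x) (𝓝 (tail μ t x)) :=
    ((hc.continuousAt (Ioi_mem_nhds hx)).tendsto).mono_left nhdsWithin_le_nhds
  have h := le_of_tendsto (htend.const_add (μ {f | f.1 t = x}))
    (eventually_nhdsWithin_of_forall fun y hy => hle y hy)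
  exact nonpos_iff_eq_zero.1 (ENNReal.le_of_add_le_add_right hlt (by simpa using h))

/-- By Mecke's formula, the expected number of points violating the claim is an integral over an
added point `f`. The level set of `f` at `t` is `μ`-null, so almost surely `f` is alone in it, and
the integral vanishes. -/
theorem ae_apply_level_set_eq_one {t : T} (hc : ContinuousOn (tail μ t) (Ioi 0)) :
    ∀ᵐ ω ∂P, ∀ g ∈ (Φ ω).atoms, 0 < g.1 t → (Φ ω).1 {f | f.1 t = g.1 t} = 1 := by
  have hev : ∀ x, MeasurableSet {f : C0 T | f.1 t = x} :=
    fun x => measurableSet_eq_fun (measurable_eval_C0 t) measurable_const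
  have hmass : Measurable fun p : PointMeasure T × C0 T => p.1.1 {f | f.1 t = p.2.1 t} :=
    Kernel.measurable_kernel_prodMk_left (κ := (kernel T).comap Prod.fst measurable_fst)
      (t := {q : (PointMeasure T × C0 T) × C0 T | q.2.1 t = q.1.2.1 t})
      (measurableSet_eq_fun ((measurable_eval_C0 t).comp measurable_snd)
        ((measurable_eval_C0 t).comp (measurable_snd.comp measurable_fst)))
  set S : Set (PointMeasure T × C0 T) :=
    {p | 0 < p.2.1 t} ∩ {p | p.1.1 {f | f.1 t = p.2.1 t} = 1}ᶜ with hS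
  have hSm : MeasurableSet S :=
    (measurableSet_lt measurable_const ((measurable_eval_C0 t).comp measurable_snd)).inter
      (hmass (measurableSet_singleton 1)).compl
  have h := hΦ.mecke (F := S.indicator 1) (measurable_one.indicator hSm)
  have hright : ∀ f, ∫⁻ ω, S.indicator (1 : _ × _ → ℝ≥0∞) ((Φ ω).addDirac f, f) ∂P = 0 := by
    intro f
    rcases le_or_gt (f.1 t) 0 with hf | hf
    · refine lintegral_eq_zero_of_ae_eq_zero (Eventually.of_forall fun ω => ?_)
      exact indicator_of_notMem (fun h => absurd h.1 (not_lt.2 hf)) _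
    · refine lintegral_eq_zero_of_ae_eq_zero ?_
      filter_upwards [hΦ.ae_apply_eq_zero (hev _)
        (hΦ.intensity_eq_zero_of_continuousOn_tail hc hf)] with ω hω
      refine indicator_of_notMem (fun h => h.2 ?_) _
      change ((Φ ω).addDirac f).1 {g | g.1 t = f.1 t} = 1
      rw [addDirac, Measure.add_apply, hω, zero_add,
        Measure.dirac_apply_of_mem (show f ∈ {g : C0 T | g.1 t = f.1 t} from rfl)]
  simp only [hright, lintegral_zero] at h
  have hleft : ∀ ω, ∫⁻ f, S.indicator (1 : _ × _ → ℝ≥0∞) (Φ ω, f) ∂(Φ ω).1 =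
      (Φ ω).1 {f | (Φ ω, f) ∈ S} := fun ω =>
    lintegral_indicator_one (measurable_prodMk_left hSm)
  simp only [hleft] at h
  have hmeas : Measurable fun ω => (Φ ω).1 {f | (Φ ω, f) ∈ S} :=
    (measurable_apply_prodMk hSm).comp hΦ.measurable
  rw [lintegral_eq_zero_iff hmeas] at h
  filter_upwards [h] with ω hω g hg hpos
  by_contra hne
  exact (apply_eq_zero_iff _ (measurable_prodMk_left hSm)).1 hω g hg ⟨hpos, hne⟩

end IsPoissonRandomMeasure

/-! ### Blocks of a partition in standardized order -/

section Blocks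

variable {k : ℕ} (τ : Finpartition (Finset.univ : Finset (Fin k)))

theorem blockMin_mem_block (j : Fin (len τ)) : blockMin τ j ∈ block τ j :=
  τ.mem_part (Finset.mem_univ _)

theorem block_mem_parts (j : Fin (len τ)) : block τ j ∈ τ.parts :=
  τ.part_mem.2 (Finset.mem_univ _)

variable {τ}

theorem mem_block_iff {i : Fin k} {j : Fin (len τ)} : i ∈ block τ j ↔ τ.part i = block τ j :=
  ⟨fun h => τ.part_eq_of_mem (block_mem_parts τ j) h,
    fun h => h ▸ τ.mem_part (Finset.mem_univ i)⟩

theorem block_injective : Function.Injective (block τ) := by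
  intro j j' h
  have hmin : ∀ j, ∀ i ∈ block τ j, blockMin τ j ≤ i := by
    intro j i hi
    exact (Finset.mem_filter.1
      (Finset.orderEmbOfFin_mem (minima τ) (card_minima τ) j)).2 i hi
  refine ((minima τ).orderEmbOfFin (card_minima τ)).injective (le_antisymm ?_ ?_)
  · exact hmin j _ (h ▸ blockMin_mem_block τ j')
  · exact hmin j' _ (h ▸ blockMin_mem_block τ j)

theorem eq_of_mem_block {i : Fin k} {j j' : Fin (len τ)} (h : i ∈ block τ j)
    (h' : i ∈ block τ j') : j = j' :=
  block_injective ((mem_block_iff.1 h).symm.trans (mem_block_iff.1 h'))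

theorem exists_mem_block (i : Fin k) : ∃ j, i ∈ block τ j := by
  have hne : (τ.part i).Nonempty := ⟨i, τ.mem_part (Finset.mem_univ i)⟩
  have hpart : τ.part ((τ.part i).min' hne) = τ.part i :=
    τ.part_eq_of_mem (τ.part_mem.2 (Finset.mem_univ i)) (Finset.min'_mem _ _)
  have hmem : (τ.part i).min' hne ∈ minima τ := by
    rw [minima, Finset.mem_filter, hpart]
    exact ⟨Finset.mem_univ _, fun i' hi' => Finset.min'_le _ _ hi'⟩
  obtain ⟨j, hj⟩ : (τ.part i).min' hne ∈
      Set.range ((minima τ).orderEmbOfFin (card_minima τ)) := by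
    rwa [Finset.range_orderEmbOfFin]
  refine ⟨j, mem_block_iff.2 ?_⟩
  rw [block, blockMin, hj, hpart]

theorem finpartition_eq_of_part_eq {σ : Finpartition (Finset.univ : Finset (Fin k))}
    (h : ∀ i, σ.part i = τ.part i) : σ = τ := by
  refine Finpartition.ext (Finset.ext fun p => ?_)
  constructor
  · intro hp
    obtain ⟨i, hi⟩ := σ.nonempty_of_mem_parts hp
    rw [← σ.part_eq_of_mem hp hi, h]
    exact τ.part_mem.2 (Finset.mem_univ i)
  · intro hp
    obtain ⟨i, hi⟩ := τ.nonempty_of_mem_parts hp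
    rw [← τ.part_eq_of_mem hp hi, ← h]
    exact σ.part_mem.2 (Finset.mem_univ i)

end Blocks

theorem measurableSet_ltOn_range {T : Type*} [MetricSpace T] {k : ℕ} (t : Fin k → T) (g : T → ℝ) :
    MeasurableSet {f : C0 T | LtOn (range t) f.1 g} := by
  have : {f : C0 T | LtOn (range t) f.1 g} = ⋂ i, {f | f.1 (t i) < g (t i)} := by
    ext f
    rw [mem_iInter]
    exact forall_mem_range
  rw [this]
  exact MeasurableSet.iInter fun i => measurableSet_lt (measurable_eval_C0 _) measurable_const

/-- Positivity of `b` serves the empty family, whose supremum is `0`; this occurs for a partition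
with one block. -/
theorem iSup_lt_of_finite {ι : Type*} [Finite ι] {a : ι → ℝ} {b : ℝ} (hb : 0 < b)
    (h : ∀ i, a i < b) : ⨆ i, a i < b := by
  cases isEmpty_or_nonempty ι
  · rwa [Real.iSup_of_isEmpty]
  · obtain ⟨i, hi⟩ := exists_eq_ciSup_of_finite (f := a)
    exact hi ▸ h i

theorem pi_dirac {ι X : Type*} [Fintype ι] [MeasurableSpace X] (x : ι → X) :
    Measure.pi (fun i => Measure.dirac (x i)) = Measure.dirac x := by
  refine Measure.pi_eq fun s hs => ?_
  rw [Measure.dirac_apply' _ (MeasurableSet.univ_pi hs)]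
  by_cases h : x ∈ univ.pi s
  · rw [indicator_of_mem h, Finset.prod_eq_one]
    · rfl
    · exact fun i _ => Measure.dirac_apply_of_mem (h i (mem_univ i))
  · rw [indicator_of_notMem h]
    simp only [mem_univ_pi, not_forall] at h
    obtain ⟨i, hi⟩ := h
    refine (Finset.prod_eq_zero (Finset.mem_univ i) ?_).symm
    rw [Measure.dirac_apply' _ (hs i), indicator_of_notMem hi]

/-! ### Regular point measures and their hitting scenarios -/

namespace PointMeasure

/-- The functions that are at least `max(M)` at the point `t`. -/
def hitting (M : PointMeasure T) (t : T) : Set (C0 T) :=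
  {f | M.max t ≤ f.1 t}

theorem measurableSet_hitting (M : PointMeasure T) (t : T) : MeasurableSet (M.hitting t) :=
  measurableSet_le measurable_const (measurable_eval_C0 t)

/-- The point measure `M` has exactly one function that is maximal at `t`, counted with
multiplicity, and its value there is positive. -/
def IsRegularAt (M : PointMeasure T) (t : T) : Prop :=
  0 < M.max t ∧ M.1 (M.hitting t) = 1

theorem measurableSet_isRegularAt (t : T) : MeasurableSet {M : PointMeasure T | M.IsRegularAt t} :=
  (measurableSet_lt measurable_const (measurable_max t)).inter
    ((measurable_apply_comp_max t (R := {p | p.2 ≤ p.1})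
      (measurableSet_le measurable_snd measurable_fst)) (measurableSet_singleton 1))

theorem isRegularAt_of_level_set {M : PointMeasure T} {t : T} (hpos : 0 < M.max t)
    (h : ∀ g ∈ M.atoms, 0 < g.1 t → M.1 {f | f.1 t = g.1 t} = 1) : M.IsRegularAt t := by
  refine ⟨hpos, ?_⟩
  obtain ⟨g, hg, hgt⟩ := exists_apply_eq_max hpos
  have h1 := h g hg (hgt ▸ hpos)
  rw [hgt] at h1
  have h0 : M.1 {f | M.max t < f.1 t} = 0 :=
    (apply_eq_zero_iff M (measurableSet_lt measurable_const (measurable_eval_C0 t))).2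
      fun f hf hf' => absurd (apply_le_max hf t) (not_le.2 hf')
  refine le_antisymm ?_ ?_
  · calc M.1 (M.hitting t) ≤ M.1 ({f | f.1 t = M.max t} ∪ {f | M.max t < f.1 t}) :=
          measure_mono fun f (hf : M.max t ≤ f.1 t) => hf.eq_or_lt.imp Eq.symm id
      _ ≤ M.1 {f | f.1 t = M.max t} + M.1 {f | M.max t < f.1 t} := measure_union_le _ _
      _ = 1 := by rw [h1, h0, add_zero]
  · rw [← h1]
    exact measure_mono fun f (hf : f.1 t = M.max t) => hf.ge

theorem IsRegularAt.restrict_hitting {M : PointMeasure T} {t : T} (h : M.IsRegularAt t) :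
    M.1.restrict (M.hitting t) = Measure.dirac (M.extremalFun t) := by
  obtain ⟨g, -, hg⟩ := M.exists_restrict_eq_dirac (M.measurableSet_hitting t) h.2
  have hset : {f : C0 T | ¬ LtOn {t} f.1 M.max} = M.hitting t := by
    ext f
    simp [LtOn, hitting]
  have hext : (M.extremal {t}).1 = M.1.restrict (M.hitting t) := by
    rw [extremal, restrict, hset]
  rw [← hext]
  exact @Classical.epsilon_spec _ (fun φ => (M.extremal {t}).1 = Measure.dirac φ)
    ⟨g, hext.trans hg⟩

theorem IsRegularAt.extremalFun_mem_hitting {M : PointMeasure T} {t : T} (h : M.IsRegularAt t) :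
    M.extremalFun t ∈ M.hitting t := by
  have h1 := h.2
  rw [← Measure.restrict_apply_self, h.restrict_hitting,
    Measure.dirac_apply' _ (M.measurableSet_hitting t)] at h1
  by_contra hn
  rw [indicator_of_notMem hn] at h1
  exact zero_ne_one h1

/-- On each hitting set `M` is the Dirac mass at the extremal function. A function in both hitting
sets thus receives the same mass from the two Dirac masses, so they coincide once it is one of the
extremal functions. -/
theorem IsRegularAt.extremalFun_eq_iff {M : PointMeasure T} {t t' : T} (h : M.IsRegularAt t)
    (h' : M.IsRegularAt t') :
    M.extremalFun t = M.extremalFun t' ↔ M.extremalFun t ∈ M.hitting t' := by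
  refine ⟨fun H => H ▸ h'.extremalFun_mem_hitting, fun H => ?_⟩
  set φ := M.extremalFun t with hφ
  have hmass : ∀ s (hs : M.IsRegularAt s), φ ∈ M.hitting s →
      M.1 {φ} = Measure.dirac (M.extremalFun s) {φ} := by
    intro s hs hm
    rw [← hs.restrict_hitting, Measure.restrict_apply (measurableSet_singleton φ),
      inter_eq_self_of_subset_left (singleton_subset_iff.2 hm)]
  have h1 := (hmass t h h.extremalFun_mem_hitting).symm.trans (hmass t' h' H)
  rw [← hφ, Measure.dirac_apply_of_mem (mem_singleton φ),
    Measure.dirac_apply' _ (measurableSet_singleton φ)]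
    at h1
  by_contra hn
  rw [indicator_of_notMem fun hm : M.extremalFun t' ∈ ({φ} : Set (C0 T)) =>
    hn (mem_singleton_iff.1 hm).symm] at h1
  exact one_ne_zero h1

section Hitting

variable {k : ℕ} {t : Fin k → T} {τ : Finpartition (Finset.univ : Finset (Fin k))}

/-- The functions that are at least `max(M)` at exactly those points `t i` with `i ∈ p`. -/
def hittingAt (t : Fin k → T) (M : PointMeasure T) (p : Finset (Fin k)) : Set (C0 T) :=
  {f | ∀ i, f ∈ M.hitting (t i) ↔ i ∈ p}

theorem measurableSet_hittingAt (M : PointMeasure T) (p : Finset (Fin k)) :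
    MeasurableSet (hittingAt t M p) := by
  have : hittingAt t M p = ⋂ i, {f | f ∈ M.hitting (t i) ↔ i ∈ p} := by
    ext f
    simp [hittingAt]
  rw [this]
  refine MeasurableSet.iInter fun i => ?_
  by_cases hi : i ∈ p
  · simpa [hi] using M.measurableSet_hitting (t i)
  · simp only [hi, iff_false]
    exact (M.measurableSet_hitting (t i)).compl

theorem mem_part_hittingScenario {M : PointMeasure T} {i i' : Fin k} :
    i' ∈ (M.hittingScenario t).part i ↔ M.extremalFun (t i) = M.extremalFun (t i') := by
  classical
  exact Finpartition.mem_part_ofSetoid_iff_rel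

/-- Replaces equality of partitions by a measurable condition on each extremal function separately,
the form that survives inside Mecke's formula. -/
theorem hittingScenario_eq_iff {M : PointMeasure T} (hM : ∀ i, M.IsRegularAt (t i)) :
    M.hittingScenario t = τ ↔
      ∀ j, M.extremalFun (t (blockMin τ j)) ∈ hittingAt t M (block τ j) := by
  constructor
  · rintro rfl j i
    rw [← (hM _).extremalFun_eq_iff (hM i), ← mem_part_hittingScenario]
    rfl
  · intro H
    refine finpartition_eq_of_part_eq fun i => Finset.ext fun i' => ?_
    obtain ⟨j, hj⟩ := exists_mem_block (τ := τ) i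
    have hφ : ∀ i, M.extremalFun (t (blockMin τ j)) = M.extremalFun (t i) ↔ i ∈ block τ j :=
      fun i => ((hM _).extremalFun_eq_iff (hM i)).trans (H j i)
    rw [mem_part_hittingScenario, mem_block_iff.1 hj, ← hφ i', (hφ i).2 hj]

theorem extremalFuns_cast {M : PointMeasure T} (h : M.hittingScenario t = τ) :
    (fun j => M.extremalFuns t (Fin.cast (congrArg len h.symm) j)) =
      fun j => M.extremalFun (t (blockMin τ j)) := by
  subst h
  rfl

/-- The pairs `(M, f)` for which `f` is the family of the extremal functions of `M`, whose hitting
scenario is `τ`, with `f ∈ A` and the sub-extremal part of `M` in `B`. -/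
def scenarioSet (t : Fin k → T) (τ : Finpartition (Finset.univ : Finset (Fin k)))
    (A : Set (Fin (len τ) → C0 T)) (B : Set (PointMeasure T)) :
    Set (PointMeasure T × (Fin (len τ) → C0 T)) :=
  {p | p.2 ∈ A ∧ (∀ i, p.1.IsRegularAt (t i)) ∧ (∀ j, p.2 j ∈ hittingAt t p.1 (block τ j)) ∧
    p.1.subExtremal (range t) ∈ B}

variable {A : Set (Fin (len τ) → C0 T)} {B : Set (PointMeasure T)}

theorem measurableSet_scenarioSet (hA : MeasurableSet A) (hB : MeasurableSet B) :
    MeasurableSet (scenarioSet t τ A B) := by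
  have hreg : MeasurableSet {M : PointMeasure T | ∀ i, M.IsRegularAt (t i)} := by
    rw [ofPred_forall]
    exact MeasurableSet.iInter fun i => measurableSet_isRegularAt (t i)
  have hhit : MeasurableSet {p : PointMeasure T × (Fin (len τ) → C0 T) |
      ∀ j, p.2 j ∈ hittingAt t p.1 (block τ j)} := by
    have : {p : PointMeasure T × (Fin (len τ) → C0 T) |
        ∀ j, p.2 j ∈ hittingAt t p.1 (block τ j)} =
        ⋂ j, ⋂ i, {p | p.1.max (t i) ≤ (p.2 j).1 (t i) ↔ i ∈ block τ j} := by
      ext p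
      simp [hittingAt, hitting]
    rw [this]
    refine MeasurableSet.iInter fun j => MeasurableSet.iInter fun i => ?_
    have hm : MeasurableSet {p : PointMeasure T × (Fin (len τ) → C0 T) |
        p.1.max (t i) ≤ (p.2 j).1 (t i)} :=
      measurableSet_le ((measurable_max (t i)).comp measurable_fst)
        ((measurable_eval_C0 (t i)).comp ((measurable_pi_apply j).comp measurable_snd))
    by_cases hi : i ∈ block τ j
    · simpa [hi] using hm
    · simp only [hi, iff_false]
      exact hm.compl
  exact (measurable_snd hA).inter ((measurable_fst hreg).inter
    (hhit.inter (((measurable_subExtremal t).comp measurable_fst) hB)))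

theorem injective_of_mem_scenarioSet {M : PointMeasure T} {f : Fin (len τ) → C0 T}
    (h : (M, f) ∈ scenarioSet t τ A B) : Function.Injective f := by
  intro j j' hjj'
  refine eq_of_mem_block (blockMin_mem_block τ j) ((h.2.2.1 j' _).1 ?_)
  change f j' ∈ _
  rw [← hjj']
  exact (h.2.2.1 j _).2 (blockMin_mem_block τ j)

/-- The set `hittingAt` for block `j` lies in the hitting set at the first point of that block,
where `M` is a Dirac mass. On the product of these sets, `M^⊗ℓ` is therefore the Dirac mass at the
tuple of extremal functions. -/
theorem pi_scenarioSet {M : PointMeasure T} (hM : ∀ i, M.IsRegularAt (t i))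
    (hA : MeasurableSet A) :
    Measure.pi (fun _ => M.1) {f | (M, f) ∈ scenarioSet t τ A B} =
      {M : PointMeasure T | (∃ h : M.hittingScenario t = τ,
          (fun j => M.extremalFuns t (Fin.cast (congrArg len h.symm) j)) ∈ A) ∧
        M.subExtremal (range t) ∈ B}.indicator 1 M := by
  by_cases hB : M.subExtremal (range t) ∈ B
  swap
  · rw [indicator_of_notMem fun h => hB h.2]
    convert measure_empty (μ := Measure.pi fun _ : Fin (len τ) => M.1)
    exact eq_empty_of_forall_notMem fun f hf => hB hf.2.2.2
  set H : Fin (len τ) → Set (C0 T) := fun j => hittingAt t M (block τ j) with hH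
  have hHm : ∀ j, MeasurableSet (H j) := fun j => M.measurableSet_hittingAt _
  set φ : Fin (len τ) → C0 T := fun j => M.extremalFun (t (blockMin τ j)) with hφ
  have hset : {f | (M, f) ∈ scenarioSet t τ A B} = A ∩ univ.pi H := by
    ext f
    simp [scenarioSet, hM, hB, hH]
  have hres : ∀ j, M.1.restrict (H j) = (Measure.dirac (φ j)).restrict (H j) := by
    intro j
    rw [← (hM (blockMin τ j)).restrict_hitting, Measure.restrict_restrict (hHm j),
      inter_eq_self_of_subset_left]
    exact fun f hf => (hf _).2 (blockMin_mem_block τ j)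
  have hmeas : MeasurableSet (A ∩ univ.pi H) := hA.inter (MeasurableSet.univ_pi hHm)
  rw [hset, ← Measure.restrict_apply hA, Measure.restrict_pi_pi]
  rw [show (fun j => M.1.restrict (H j)) = fun j => (Measure.dirac (φ j)).restrict (H j) from
    funext hres]
  rw [← Measure.restrict_pi_pi, pi_dirac, Measure.restrict_apply hA,
    Measure.dirac_apply' _ hmeas]
  have hiff : φ ∈ A ∩ univ.pi H ↔ M ∈ {M : PointMeasure T | (∃ h : M.hittingScenario t = τ,
      (fun j => M.extremalFuns t (Fin.cast (congrArg len h.symm) j)) ∈ A) ∧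
        M.subExtremal (range t) ∈ B} := by
    constructor
    · rintro ⟨h1, h2⟩
      have h := (hittingScenario_eq_iff hM).2 fun j => h2 j (mem_univ j)
      exact ⟨⟨h, (extremalFuns_cast h).symm ▸ h1⟩, hB⟩
    · rintro ⟨⟨h, h1⟩, -⟩
      rw [extremalFuns_cast h] at h1
      exact ⟨h1, fun j _ => (hittingScenario_eq_iff hM).1 h j⟩
  by_cases h : φ ∈ A ∩ univ.pi H
  · rw [indicator_of_mem h, indicator_of_mem (hiff.1 h)]
    rfl
  · rw [indicator_of_notMem h, indicator_of_notMem (mt hiff.2 h)]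

end Hitting

theorem mem_atoms_addDiracs {ι : Type*} [Fintype ι] {M : PointMeasure T} {f : ι → C0 T}
    {g : C0 T} : g ∈ (M.addDiracs f).atoms ↔ g ∈ M.atoms ∨ ∃ j, f j = g := by
  simp [atoms, addDiracs, or_iff_not_imp_left]

/-! ### Adding the extremal functions to a point measure -/

section Dominating

variable {T : Type*} [MetricSpace T] {k : ℕ} {t : Fin k → T}
  {τ : Finpartition (Finset.univ : Finset (Fin k))}

/-- The families `f` such that, for every `j`, `f j` is greater than all the other `f j'` at the
points of the block `j` of `τ`. -/
def dominating (t : Fin k → T) (τ : Finpartition (Finset.univ : Finset (Fin k))) :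
    Set (Fin (len τ) → C0 T) :=
  {f | ∀ j, LtOn (t '' block τ j) (fun s => ⨆ j' : {j' // j' ≠ j}, (f j').1 s) (f j).1}

theorem apply_lt_of_mem_dominating {f : Fin (len τ) → C0 T} (hf : f ∈ dominating t τ)
    {i : Fin k} {j : Fin (len τ)} (hi : i ∈ block τ j) {j' : Fin (len τ)} (hj' : j' ≠ j) :
    (f j').1 (t i) < (f j).1 (t i) :=
  (le_ciSup (f := fun j' : {j' // j' ≠ j} => (f j').1 (t i)) (finite_range _).bddAbove
    ⟨j', hj'⟩).trans_lt (hf j _ ⟨i, hi, rfl⟩)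

theorem apply_le_of_mem_dominating {f : Fin (len τ) → C0 T} (hf : f ∈ dominating t τ)
    {i : Fin k} {j : Fin (len τ)} (hi : i ∈ block τ j) (j' : Fin (len τ)) :
    (f j').1 (t i) ≤ (f j).1 (t i) := by
  by_cases h : j' = j
  · rw [h]
  · exact (apply_lt_of_mem_dominating hf hi h).le

theorem iSup_eq_of_mem_dominating {f : Fin (len τ) → C0 T} (hf : f ∈ dominating t τ)
    {i : Fin k} {j : Fin (len τ)} (hi : i ∈ block τ j) :
    ⨆ j', (f j').1 (t i) = (f j).1 (t i) := by
  have : Nonempty (Fin (len τ)) := ⟨j⟩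
  exact le_antisymm (ciSup_le (apply_le_of_mem_dominating hf hi))
    (le_ciSup (f := fun j' => (f j').1 (t i)) (finite_range _).bddAbove j)

theorem apply_pos_of_mem_dominating {f : Fin (len τ) → C0 T} (hf : f ∈ dominating t τ)
    {i : Fin k} {j : Fin (len τ)} (hi : i ∈ block τ j) : 0 < (f j).1 (t i) :=
  (Real.iSup_nonneg fun j' : {j' // j' ≠ j} => (f j').2.1 (t i)).trans_lt
    (hf j _ ⟨i, hi, rfl⟩)

end Dominating

section Hitting

variable {k : ℕ} {t : Fin k → T} {τ : Finpartition (Finset.univ : Finset (Fin k))}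

variable {A : Set (Fin (len τ) → C0 T)} {B : Set (PointMeasure T)} {M : PointMeasure T}
  {f : Fin (len τ) → C0 T}

theorem subExtremal_addDiracs (h1 : ∀ g ∈ M.atoms, LtOn (range t) g.1 (M.addDiracs f).max)
    (h2 : ∀ j, ¬ LtOn (range t) (f j).1 (M.addDiracs f).max) :
    (M.addDiracs f).subExtremal (range t) = M := by
  set L : Set (C0 T) := {g | LtOn (range t) g.1 (M.addDiracs f).max} with hL
  have hLm : MeasurableSet L := measurableSet_ltOn_range t _
  refine Subtype.ext (Measure.ext fun s hs => ?_)
  change (M.1 + ∑ j, Measure.dirac (f j)).restrict L s = M.1 s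
  rw [Measure.restrict_apply hs, Measure.add_apply, Measure.finsetSum_apply, Finset.sum_eq_zero,
    add_zero]
  · have h0 : M.1 (s \ L) = 0 :=
      (M.apply_eq_zero_iff (hs.diff hLm)).2 fun g hg hg' => hg'.2 (h1 g hg)
    rw [← measure_inter_add_sdiff s hLm, h0, add_zero]
  · intro j _
    rw [Measure.dirac_apply' _ (hs.inter hLm), indicator_of_notMem]
    exact fun h => h2 j h.2

/-- With `N = M + ∑ δ_{f j}`, regularity leaves no room at `t i` for a maximal point besides the `f
j` of its block, so all atoms of `M` lie strictly below. Conversely, domination makes `N.max` equal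
`f j` on block `j`. Either way the sub-extremal part of `N` is `M`. -/
theorem addDiracs_mem_scenarioSet_iff :
    (M.addDiracs f, f) ∈ scenarioSet t τ A B ↔
      f ∈ A ∧ f ∈ dominating t τ ∧
        M ∈ B ∩ CMinus (range t) (fun s => ⨆ j, (f j).1 s) := by
  set N := M.addDiracs f with hN
  have hfN : ∀ j, f j ∈ N.atoms := fun j => mem_atoms_addDiracs.2 (Or.inr ⟨j, rfl⟩)
  have hMN : ∀ g ∈ M.atoms, g ∈ N.atoms := fun g hg => mem_atoms_addDiracs.2 (Or.inl hg)
  have hnot : (∀ j, f j ∈ hittingAt t N (block τ j)) → ∀ j, ¬ LtOn (range t) (f j).1 N.max :=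
    fun h j hlt => absurd (hlt _ ⟨blockMin τ j, rfl⟩)
      (not_lt.2 ((h j _).2 (blockMin_mem_block τ j)))
  have hsplit : ∀ i, N.1 (N.hitting (t i)) =
      M.1 (N.hitting (t i)) + ∑ j, Measure.dirac (f j) (N.hitting (t i)) := by
    intro i
    change (M.1 + ∑ j, Measure.dirac (f j)) _ = _
    rw [Measure.add_apply, Measure.finsetSum_apply]
  constructor
  · rintro ⟨hA, hreg, hhit, hB⟩
    change f ∈ A at hA
    change ∀ i, N.IsRegularAt (t i) at hreg
    change ∀ j, f j ∈ hittingAt t N (block τ j) at hhit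
    change N.subExtremal (range t) ∈ B at hB
    have hlt : ∀ g ∈ M.atoms, LtOn (range t) g.1 N.max := by
      rintro g hg _ ⟨i, rfl⟩
      obtain ⟨j, hj⟩ := exists_mem_block (τ := τ) i
      have h0 : M.1 (N.hitting (t i)) = 0 := by
        -- The hitting set has total mass one, and `f j` alone uses it up.
        have h1 : M.1 (N.hitting (t i)) + 1 ≤ 0 + 1 := by
          rw [zero_add]
          calc M.1 (N.hitting (t i)) + 1
              = M.1 (N.hitting (t i)) + Measure.dirac (f j) (N.hitting (t i)) := by
                rw [Measure.dirac_apply_of_mem ((hhit j i).2 hj)]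
            _ ≤ M.1 (N.hitting (t i)) + ∑ j, Measure.dirac (f j) (N.hitting (t i)) := by
                gcongr
                exact Finset.single_le_sum (f := fun j => Measure.dirac (f j) (N.hitting (t i)))
                  (fun _ _ => zero_le) (Finset.mem_univ j)
            _ = 1 := by rw [← hsplit, (hreg i).2]
        exact nonpos_iff_eq_zero.1 (ENNReal.le_of_add_le_add_right ENNReal.one_ne_top h1)
      exact not_le.1 ((M.apply_eq_zero_iff (N.measurableSet_hitting _)).1 h0 g hg)
    refine ⟨hA, ?_, ?_, ?_⟩
    · rintro j _ ⟨i, hi, rfl⟩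
      have hmax : N.max (t i) ≤ (f j).1 (t i) := (hhit j i).2 hi
      refine iSup_lt_of_finite ((hreg i).1.trans_le hmax) ?_
      rintro ⟨j', hj'⟩
      refine lt_of_lt_of_le (not_le.1 fun h => hj' ?_) hmax
      exact eq_of_mem_block ((hhit j' i).1 h) hi
    · rwa [subExtremal_addDiracs hlt (hnot hhit)] at hB
    · rintro g hg _ ⟨i, rfl⟩
      obtain ⟨j, hj⟩ := exists_mem_block (τ := τ) i
      have hmax : N.max (t i) ≤ (f j).1 (t i) := (hhit j i).2 hj
      exact (hlt g hg _ ⟨i, rfl⟩).trans_le (hmax.trans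
        (le_ciSup (f := fun j' => (f j').1 (t i)) (finite_range _).bddAbove j))
  · rintro ⟨hA, hf, hB, hC⟩
    have hgt : ∀ g ∈ M.atoms, ∀ i j, i ∈ block τ j → g.1 (t i) < (f j).1 (t i) := by
      intro g hg i j hi
      rw [← iSup_eq_of_mem_dominating hf hi]
      exact hC g hg _ ⟨i, rfl⟩
    have hmax : ∀ i j, i ∈ block τ j → N.max (t i) = (f j).1 (t i) := by
      intro i j hi
      refine le_antisymm (max_le ((f j).2.1 _) fun g hg => ?_) (apply_le_max (hfN j) _)
      rcases mem_atoms_addDiracs.1 hg with hg | ⟨j', rfl⟩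
      · exact (hgt g hg i j hi).le
      · exact apply_le_of_mem_dominating hf hi j'
    have hhit : ∀ j, f j ∈ hittingAt t N (block τ j) := by
      intro j i
      obtain ⟨j', hj'⟩ := exists_mem_block (τ := τ) i
      change N.max (t i) ≤ (f j).1 (t i) ↔ _
      rw [hmax i j' hj']
      constructor
      · intro h
        by_cases hjj' : j = j'
        · rwa [hjj']
        · exact absurd h (not_le.2 (apply_lt_of_mem_dominating hf hj' hjj'))
      · intro hi
        rw [eq_of_mem_block hi hj']
    have hlt : ∀ g ∈ M.atoms, LtOn (range t) g.1 N.max := by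
      rintro g hg _ ⟨i, rfl⟩
      obtain ⟨j, hj⟩ := exists_mem_block (τ := τ) i
      rw [hmax i j hj]
      exact hgt g hg i j hj
    refine ⟨hA, fun i => ?_, hhit, ?_⟩
    · obtain ⟨j, hj⟩ := exists_mem_block (τ := τ) i
      change N.IsRegularAt (t i)
      refine ⟨(hmax i j hj).symm ▸ apply_pos_of_mem_dominating hf hj, ?_⟩
      have h0 : M.1 (N.hitting (t i)) = 0 :=
        (M.apply_eq_zero_iff (N.measurableSet_hitting _)).2 fun g hg =>
          not_le.2 (hlt g hg _ ⟨i, rfl⟩)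
      rw [hsplit, h0, zero_add, Finset.sum_eq_single j,
        Measure.dirac_apply_of_mem ((hhit j i).2 hj)]
      · intro j' _ hj'
        rw [Measure.dirac_apply' _ (N.measurableSet_hitting _), indicator_of_notMem]
        exact fun h => hj' (eq_of_mem_block ((hhit j' i).1 h) hj)
      · simp
    · change N.subExtremal (range t) ∈ B
      rwa [subExtremal_addDiracs hlt (hnot hhit)]

end Hitting

end PointMeasure

theorem IsPoissonRandomMeasure.ae_isRegularAt {Ω : Type*} [MeasurableSpace Ω] {P : Measure Ω}
    [IsProbabilityMeasure P] {μ : Measure (C0 T)} {Φ : Ω → PointMeasure T}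
    (hΦ : IsPoissonRandomMeasure P μ Φ) {k : ℕ} {t : Fin k → T} (hA : AssumptionA μ t) :
    ∀ᵐ ω ∂P, ∀ i, (Φ ω).IsRegularAt (t i) := by
  rw [ae_all_iff]
  intro i
  filter_upwards [hΦ.ae_max_pos (hA i).2, hΦ.ae_apply_level_set_eq_one (hA i).1] with ω h1 h2
  exact isRegularAt_of_level_set h1 h2

end MaxID

end

/-! ### The distribution of the hitting scenario -/

open MaxID in
theorem proposition2p3 {T : Type*} [MetricSpace T] [CompactSpace T]
    {Ω : Type*} [MeasurableSpace Ω] (P : Measure Ω) [IsProbabilityMeasure P]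
    (μ : Measure (C0 T)) (Φ : Ω → PointMeasure T) (hΦ : IsPoissonRandomMeasure P μ Φ)
    {k : ℕ} (t : Fin k → T) (ht : Function.Injective t) (hA : AssumptionA μ t)
    (τ : Finpartition (Finset.univ : Finset (Fin k)))
    (A : Set (Fin (len τ) → C0 T)) (hAm : MeasurableSet A)
    (B : Set (PointMeasure T)) (hBm : MeasurableSet B) :
    P {ω | (∃ h : (Φ ω).hittingScenario t = τ,
          (fun j => (Φ ω).extremalFuns t (Fin.cast (congrArg len h.symm) j)) ∈ A) ∧
        (Φ ω).subExtremal (range t) ∈ B} =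
      ∫⁻ f in A,
        {f : Fin (len τ) → C0 T |
            ∀ j, LtOn (t '' block τ j) (fun s => ⨆ j' : {j' // j' ≠ j}, (f j').1 s)
              (f j).1}.indicator
          (fun f => P {ω | Φ ω ∈ B ∩ PointMeasure.CMinus (range t) (fun s => ⨆ j, (f j).1 s)}) f
        ∂(Measure.pi fun _ => μ) := by
  open PointMeasure in
  classical
  set S := scenarioSet t τ A B with hS
  have hSm : MeasurableSet S := measurableSet_scenarioSet hAm hBm
  have hmass : Measurable fun ω => Measure.pi (fun _ => (Φ ω).1) {f | (Φ ω, f) ∈ S} := by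
    have h := measurable_lintegral_pi (len τ) (X := PointMeasure T) (N := id) measurable_id
      (F := S.indicator 1) (measurable_one.indicator hSm)
    have h' : ∀ M : PointMeasure T, ∫⁻ f, S.indicator (1 : _ × _ → ℝ≥0∞) (M, f)
        ∂(Measure.pi fun _ => M.1) = Measure.pi (fun _ => M.1) {f | (M, f) ∈ S} :=
      fun M => lintegral_indicator_one (measurable_prodMk_left hSm)
    simp only [id, h'] at h
    exact h.comp hΦ.measurable
  have hreg := hΦ.ae_isRegularAt hA
  have hleft : P {ω | (∃ h : (Φ ω).hittingScenario t = τ,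
          (fun j => (Φ ω).extremalFuns t (Fin.cast (congrArg len h.symm) j)) ∈ A) ∧
        (Φ ω).subExtremal (range t) ∈ B} =
      ∫⁻ ω, Measure.pi (fun _ => (Φ ω).1) {f | (Φ ω, f) ∈ S} ∂P := by
    set E := {ω | (∃ h : (Φ ω).hittingScenario t = τ,
          (fun j => (Φ ω).extremalFuns t (Fin.cast (congrArg len h.symm) j)) ∈ A) ∧
        (Φ ω).subExtremal (range t) ∈ B} with hE
    have hae : (fun ω => Measure.pi (fun _ => (Φ ω).1) {f | (Φ ω, f) ∈ S}) =ᵐ[P]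
        E.indicator 1 := by
      filter_upwards [hreg] with ω hω
      exact pi_scenarioSet hω hAm
    -- The extremal functions come from a choice operator, so measurability of the event is read off
    -- from its almost sure equality with a measurable mass.
    have hEm : NullMeasurableSet E P := by
      rw [← aemeasurable_indicator_const_iff (1 : ℝ≥0∞)]
      exact hmass.aemeasurable.congr hae
    rw [lintegral_congr_ae hae, lintegral_indicator_one₀ hEm]
  have hmecke := hΦ.mecke_pi (F := S.indicator 1) (measurable_one.indicator hSm)
    fun M f hf => indicator_of_notMem (fun h => hf (injective_of_mem_scenarioSet h)) _
  have hinner : ∀ ω, ∫⁻ f, S.indicator (1 : _ × _ → ℝ≥0∞) (Φ ω, f)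
      ∂(Measure.pi fun _ => (Φ ω).1) = Measure.pi (fun _ => (Φ ω).1) {f | (Φ ω, f) ∈ S} :=
    fun ω => lintegral_indicator_one (measurable_prodMk_left hSm)
  -- Only the integrands in `f` remain to be compared, and the deterministic equivalence does so
  -- pointwise.
  rw [hleft, ← lintegral_congr hinner, hmecke, ← lintegral_indicator hAm]
  refine lintegral_congr fun f => ?_
  have hslice : MeasurableSet {ω | ((Φ ω).addDiracs f, f) ∈ S} :=
    (measurable_addDiracs.comp (hΦ.measurable.prodMk measurable_const)).prodMk
      measurable_const hSm
  refine (lintegral_indicator_one hslice).trans ?_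
  simp only [hS, addDiracs_mem_scenarioSet_iff]
  by_cases hfA : f ∈ A
  · by_cases hfd : f ∈ dominating t τ
    · rw [indicator_of_mem hfA]
      refine Eq.trans ?_ (indicator_of_mem (s := dominating t τ) hfd _).symm
      simp only [hfA, hfd, true_and]
    · rw [indicator_of_mem hfA]
      refine Eq.trans ?_ (indicator_of_notMem (s := dominating t τ) hfd _).symm
      simp [hfd]
  · rw [indicator_of_notMem hfA]
    simp [hfA]
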